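/- **Definitions.** Let $(X,d)$ be a complete metric space. $X$ is *quasiconvex* if there are $\delta>0$ and $C<\infty$ such that any two points $x,y\in X$ with $d(x,y)\le\delta$ can be joined by a Lipschitz curve $\gamma:[0,1]\to X$ of length at most $C\,d(x,y)$. For $k\ge 0$ let $\mathcal D^k(X)$ be the set of tuples $(f,\pi_1,\dots,\pi_k)$ of Lipschitz functions $X\to\mathbb R$ with $f$ bounded. A *$k$-dimensional metric current* (in the sense of Ambrosio–Kirchheim) is a multilinear functional $T$ on $\mathcal D^k(X)$ such that 1. $T(f,\pi^j_1,\dots,\pi^j_k)\to T(f,\pi_1,\dots,\pi_k)$ whenever $\pi_i^j\to\pi_i$ pointwise as $j\to\infty$ and $\sup_{i,j}\operatorname{Lip}(\pi_i^j)<\infty$; 2. $T(f,\pi_1,\dots,\pi_k)=0$ whenever $\{f\ne0\}\subset\bigcup_{i=1}^kB_i$ with Borel sets $B_i$ such that $\pi_i$ is constant on $B_i$; 3. there is a finite Borel measure $\mu$ on $X$ with $|T(f,\pi_1,\dots,\pi_k)|\le\prod_{i=1}^k\operatorname{Lip}(\pi_i)\int_X|f|\,d\mu$ for all $(f,\pi_1,\dots,\pi_k)\in\mathcal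 D^k(X)$. The minimal such $\mu$ is denoted $\|T\|$, and $\mathbf M(T):=\|T\|(X)$ is the mass of $T$. $T$ extends uniquely to first arguments that are bounded Borel functions, continuously in $L^1(\|T\|)$, and $(T\llcorner A)(f,\pi_1,\dots,\pi_k):=T(f\chi_A,\pi_1,\dots,\pi_k)$ for Borel $A\subset X$. For $k\ge1$ the boundary is $\partial T(f,\pi_1,\dots,\pi_{k-1}):=T(1,f,\pi_1,\dots,\pi_{k-1})$. For a Lipschitz map $\varphi$, $\varphi_\#T(g,\tau_1,\dots,\tau_k):=T(g\circ\varphi,\tau_1\circ\varphi,\dots,\tau_k\circ\varphi)$. The space $\mathbf I_0(X)$ of $0$-dimensional *integral currents* consists of the $0$-dimensional metric currents of the form $T(f)=\sum_i\theta_if(x_i)$ with countably many $\theta_i\in\mathbb Z$ and $x_i\in X$. For $k\ge1$, $\mathbf I_k(X)$ consists of the $k$-dimensional metric currents $T$ such that - $\|T\|$ is concentrated on a countably $\mathcal H^k$-rectifiable set (an $\mathcal H^k$-measurable set covered, up to an $\mathcal H^k$-null set, by countably many Lipschitz images of subsets of $\mathbb R^k$) and vanishes on $\mathcal H^k$-negligible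 sets; - for every Lipschitz map $\varphi:X\to\mathbb R^k$ and every open $U\subset X$ there is $\theta\in L^1(\mathbb R^k,\mathbb Z)$ with $\varphi_\#(T\llcorner U)(f,\pi_1,\dots,\pi_k)=\int_{\mathbb R^k}\theta f\det\left(\partial\pi_i/\partial x_j\right)d\mathcal L^k$ for all $(f,\pi_1,\dots,\pi_k)\in\mathcal D^k(\mathbb R^k)$; - $\partial T$ satisfies the finite mass condition 3. The *integral filling volume* of $T\in\mathbf I_k(X)$ is $$\operatorname{Fillvol}(T):=\inf\{\mathbf M(V): V\in\mathbf I_{k+1}(X),\ \partial V=T\},\qquad \inf\emptyset:=\infty .$$ **Theorem.** Let $(X,d)$ be a complete quasiconvex metric space, let $T\in\mathbf I_0(X)$, and let $(T_m)_{m\in\mathbb N}\subset\mathbf I_0(X)$ be a sequence that is bounded, i.e. $\sup_m\mathbf M(T_m)<\infty$. Then $(T_m)$ converges weakly to $T$, that is, $T_m(f)\to T(f)$ for every bounded Lipschitz function $f:X\to\mathbb R$, if and only if $$\operatorname{Fillvol}(T-T_m)\to0\quad\text{as } m\to\infty .$$ -/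

import Mathlib

open MeasureTheory Filter Topology Set
open scoped NNReal ENNReal

noncomputable section

namespace MetricCurrent

variable {X Y : Type*} [MetricSpace X] [MetricSpace Y]

/-! ### Lipschitz functions and functionals on metric forms -/

/-- The real vector space of all Lipschitz functions `X → ℝ`. -/
def Lip (X : Type*) [MetricSpace X] : Submodule ℝ (X → ℝ) where
  carrier := {f | ∃ K : ℝ≥0, LipschitzWith K f}
  zero_mem' := ⟨0, LipschitzWith.const 0⟩
  add_mem' := by
    rintro f g ⟨K, hK⟩ ⟨L, hL⟩
    exact ⟨K + L, hK.add hL⟩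
  smul_mem' := by
    rintro c f ⟨K, hK⟩
    exact ⟨‖c‖₊ * K, (lipschitzWith_smul c).comp hK⟩

/-- The real vector space of all bounded Lipschitz functions `X → ℝ`. -/
def LipB (X : Type*) [MetricSpace X] : Submodule ℝ (X → ℝ) where
  carrier := {f | (∃ K : ℝ≥0, LipschitzWith K f) ∧ ∃ M : ℝ, ∀ x, |f x| ≤ M}
  zero_mem' := ⟨⟨0, LipschitzWith.const 0⟩, 0, fun x => by simp⟩
  add_mem' := by
    rintro f g ⟨⟨K, hK⟩, M, hM⟩ ⟨⟨L, hL⟩, N, hN⟩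
    exact ⟨⟨K + L, hK.add hL⟩, M + N,
      fun x => (abs_add_le _ _).trans (add_le_add (hM x) (hN x))⟩
  smul_mem' := by
    rintro c f ⟨⟨K, hK⟩, M, hM⟩
    refine ⟨⟨‖c‖₊ * K, (lipschitzWith_smul c).comp hK⟩, |c| * M, fun x => ?_⟩
    rw [Pi.smul_apply, smul_eq_mul, abs_mul]
    exact mul_le_mul_of_nonneg_left (hM x) (abs_nonneg c)

theorem lipB_le_lip (X : Type*) [MetricSpace X] : LipB X ≤ Lip X := fun _ hf => hf.1

/-- The constant function `1`. -/
def LipB.one (X : Type*) [MetricSpace X] : LipB X :=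
  ⟨fun _ => 1, ⟨0, LipschitzWith.const 1⟩, 1, fun _ => by simp⟩

/-- `g ∘ φ` for `g` Lipschitz and `φ` a Lipschitz map. -/
def Lip.comp (g : Lip Y) (φ : X → Y) (hφ : ∃ K : ℝ≥0, LipschitzWith K φ) : Lip X :=
  ⟨fun x => (g : Y → ℝ) (φ x), by
    obtain ⟨K, hK⟩ := hφ
    obtain ⟨L, hL⟩ := g.2
    exact ⟨L * K, hL.comp hK⟩⟩

/-- `g ∘ φ` for `g` bounded Lipschitz and `φ` a Lipschitz map. -/
def LipB.comp (g : LipB Y) (φ : X → Y) (hφ : ∃ K : ℝ≥0, LipschitzWith K φ) : LipB X :=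
  ⟨fun x => (g : Y → ℝ) (φ x), by
    obtain ⟨K, hK⟩ := hφ
    obtain ⟨⟨L, hL⟩, M, hM⟩ := g.2
    exact ⟨⟨L * K, hL.comp hK⟩, M, fun x => hM (φ x)⟩⟩

/-- Multilinear functionals `T(f, π₁, …, π_k)` on the tuples `(f, π₁, …, π_k)` of Lipschitz
functions on `X` with `f` bounded. -/
abbrev Functional (X : Type*) [MetricSpace X] (k : ℕ) : Type _ :=
  LipB X →ₗ[ℝ] MultilinearMap ℝ (fun _ : Fin k => Lip X) ℝ

/-- The boundary `∂T(f, π₁, …, π_k) = T(1, f, π₁, …, π_k)`. -/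
def boundary {k : ℕ} (T : Functional X (k + 1)) : Functional X k :=
  (T (LipB.one X)).curryLeft ∘ₗ Submodule.inclusion (lipB_le_lip X)

theorem boundary_apply {k : ℕ} (T : Functional X (k + 1)) (f : LipB X) (π : Fin k → Lip X) :
    boundary T f π = T (LipB.one X) (Fin.cons (Submodule.inclusion (lipB_le_lip X) f) π) := rfl

/-! ### Metric currents, mass, restriction -/

section Currents

variable [MeasurableSpace X] [BorelSpace X] {k : ℕ}

/-- `|T(f, π)| ≤ ∏ Lip(π_i) ∫ |f| dμ` for all `(f, π)`; the numbers `K i` run over all Lipschitz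
constants of the `π_i`, in particular over the smallest ones. -/
def Controls (T : Functional X k) (μ : Measure X) : Prop :=
  ∀ (f : LipB X) (π : Fin k → Lip X) (K : Fin k → ℝ≥0),
    (∀ i, LipschitzWith (K i) (π i : X → ℝ)) →
      |T f π| ≤ (∏ i, (K i : ℝ)) * ∫ x, |(f : X → ℝ) x| ∂μ

/-- The finite mass condition. -/
def HasFiniteMass (T : Functional X k) : Prop :=
  ∃ μ : Measure X, IsFiniteMeasure μ ∧ Controls T μ

/-- The continuity condition. -/
def IsContinuous (T : Functional X k) : Prop :=
  ∀ (f : LipB X) (π : ℕ → Fin k → Lip X) (π' : Fin k → Lip X),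
    (∃ K : ℝ≥0, ∀ j i, LipschitzWith K (π j i : X → ℝ)) →
    (∀ i x, Tendsto (fun j => (π j i : X → ℝ) x) atTop (𝓝 ((π' i : X → ℝ) x))) →
      Tendsto (fun j => T f (π j)) atTop (𝓝 (T f π'))

/-- The locality condition. -/
def IsLocal (T : Functional X k) : Prop :=
  ∀ (f : LipB X) (π : Fin k → Lip X) (B : Fin k → Set X),
    (∀ i, MeasurableSet (B i)) →
    {x | (f : X → ℝ) x ≠ 0} ⊆ ⋃ i, B i →
    (∀ i, ∃ c : ℝ, ∀ x ∈ B i, (π i : X → ℝ) x = c) →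
      T f π = 0

/-- `k`-dimensional metric currents. -/
structure IsCurrent (T : Functional X k) : Prop where
  continuous : IsContinuous T
  isLocal : IsLocal T
  finiteMass : HasFiniteMass T

/-- The mass measure `‖T‖`: the least finite Borel measure controlling `T`, as an infimum in the
complete lattice of measures. -/
def massMeasure (T : Functional X k) : Measure X :=
  sInf {μ : Measure X | IsFiniteMeasure μ ∧ Controls T μ}

/-- The mass `M(T) = ‖T‖(X)`. -/
def mass (T : Functional X k) : ℝ≥0∞ := massMeasure T univ

/-- The extension of `T(·, π)` to bounded Borel functions `g`: the limit of `T(f, π)` as the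
bounded Lipschitz functions `f` tend to `g` in `L¹(‖T‖)`. -/
def extend (T : Functional X k) (g : X → ℝ) (π : Fin k → Lip X) : ℝ :=
  limUnder
    (comap (fun f : LipB X => ∫⁻ x, ‖(f : X → ℝ) x - g x‖ₑ ∂(massMeasure T)) (𝓝 0))
    (fun f => T f π)

/-- The restriction of `T` to `A`: `(f, π) ↦ T(f χ_A, π)`. -/
def restrict (T : Functional X k) (A : Set X) (f : LipB X) (π : Fin k → Lip X) : ℝ :=
  extend T (A.indicator (f : X → ℝ)) π

/-- The push-forward `φ_# S(f, π) = S(f ∘ φ, π ∘ φ)` under a Lipschitz map `φ`. -/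
def pushforward (S : LipB X → (Fin k → Lip X) → ℝ) (φ : X → Y)
    (hφ : ∃ K : ℝ≥0, LipschitzWith K φ) (f : LipB Y) (π : Fin k → Lip Y) : ℝ :=
  S (LipB.comp f φ hφ) (fun i => Lip.comp (π i) φ hφ)

/-! ### Rectifiable and integral currents -/

/-- Countably `ℋ^k`-rectifiable sets (the normalization of `ℋ^k` is irrelevant, as only
measurability and null sets enter). -/
def IsCountablyRectifiable (k : ℕ) (A : Set X) : Prop :=
  (Measure.hausdorffMeasure (X := X) (k : ℝ)).toOuterMeasure.IsCaratheodory A ∧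
  ∃ (B : ℕ → Set (EuclideanSpace ℝ (Fin k))) (f : ∀ i, B i → X),
    (∀ i, ∃ K : ℝ≥0, LipschitzWith K (f i)) ∧
    Measure.hausdorffMeasure (k : ℝ) (A \ ⋃ i, range (f i)) = 0

/-- The current `(f, π) ↦ ∫ θ f det(∂π_i/∂x_j) dℒ^k` on `ℝ^k`. -/
def euclideanCurrent (θ : EuclideanSpace ℝ (Fin k) → ℤ)
    (f : LipB (EuclideanSpace ℝ (Fin k))) (π : Fin k → Lip (EuclideanSpace ℝ (Fin k))) : ℝ :=
  ∫ x, (θ x : ℝ) * (f : EuclideanSpace ℝ (Fin k) → ℝ) x *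
    (Matrix.of fun i j : Fin k =>
      fderiv ℝ (π i : EuclideanSpace ℝ (Fin k) → ℝ) x (EuclideanSpace.single j 1)).det

/-- Integer rectifiability of a current of dimension `k ≥ 1`. -/
structure IsIntegerRectifiablePos (T : Functional X k) : Prop where
  concentrated : ∃ A : Set X, IsCountablyRectifiable k A ∧ massMeasure T Aᶜ = 0
  vanishes : ∀ N : Set X, Measure.hausdorffMeasure (k : ℝ) N = 0 → massMeasure T N = 0
  integer : ∀ (φ : X → EuclideanSpace ℝ (Fin k)) (hφ : ∃ K : ℝ≥0, LipschitzWith K φ)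
    (U : Set X), IsOpen U →
    ∃ θ : EuclideanSpace ℝ (Fin k) → ℤ, Integrable (fun x => (θ x : ℝ)) ∧
      ∀ f π, pushforward (restrict T U) φ hφ f π = euclideanCurrent θ f π

/-- Integer rectifiability of a `0`-dimensional current: `T(f) = ∑ θ_i f(x_i)` with countably many
integers `θ_i` and points `x_i`. -/
def IsIntegerRectifiableZero (T : Functional X 0) : Prop :=
  ∃ (ι : Type) (_ : Countable ι) (θ : ι → ℤ) (x : ι → X),
    ∀ (f : LipB X) (π : Fin 0 → Lip X), HasSum (fun i => (θ i : ℝ) * (f : X → ℝ) (x i)) (T f π)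

/-- Integral currents: integer rectifiable currents whose boundary, in dimension `k ≥ 1`, has
finite mass. -/
def IsIntegral : ∀ {k : ℕ}, Functional X k → Prop
  | 0, T => IsCurrent T ∧ IsIntegerRectifiableZero T
  | _ + 1, T => IsCurrent T ∧ IsIntegerRectifiablePos T ∧ HasFiniteMass (boundary T)

/-- The integral filling volume, `∞` if there is no integral filling. -/
def fillvol (T : Functional X k) : ℝ≥0∞ :=
  ⨅ (V : Functional X (k + 1)) (_ : IsIntegral V ∧ boundary V = T), mass V

/-- Weak convergence, i.e. pointwise convergence of functionals. -/
def WeaklyConverges (Tm : ℕ → Functional X k) (T : Functional X k) : Prop :=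
  ∀ (f : LipB X) (π : Fin k → Lip X), Tendsto (fun m => Tm m f π) atTop (𝓝 (T f π))

end Currents

/-- Quasiconvexity: for some `δ > 0` and some constant `C`, any two points at distance at most `δ`
are joined by a Lipschitz curve on `[0,1]` of length at most `C d(x,y)`. -/
def IsQuasiconvex (X : Type*) [MetricSpace X] : Prop :=
  ∃ δ : ℝ, 0 < δ ∧ ∃ C : ℝ, ∀ x y : X, dist x y ≤ δ →
    ∃ γ : ℝ → X, (∃ K : ℝ≥0, LipschitzOnWith K γ (Icc 0 1)) ∧ γ 0 = x ∧ γ 1 = y ∧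
      eVariationOn γ (Icc 0 1) ≤ ENNReal.ofReal (C * dist x y)

end MetricCurrent

end

namespace MetricCurrent

variable {X : Type*} [MetricSpace X]

/-! Easy direction. If `V` fills `T - Tm`, then `(T - Tm)(f) = V(1, f)`, which is at most `Lip(f) *
M(V)`; so small fillings force weak convergence. The point to prove is that `massMeasure`, defined
as an infimum of measures, still controls the functional (`controls_massMeasure`). For fixed `π` the
functional `T(·, π)` has an `L²` density with respect to one controlling measure, and the measure
given by the absolute value of this density, divided by the product of Lipschitz constants, lies
below every controlling measure, hence below their infimum.

Hard direction. Each 0-dimensional integral current is a finite sum of signed unit point masses, at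
most as many as its mass. The value `(T - Tm)(1)` is an integer tending to 0, so eventually `T - Tm`
has as many positive as negative points; padding both sides by a common point makes this number a
constant `N`. The key lemma `eventually_exists_perm_dist_lt` says that weak convergence of such
differences to 0 forces the positive points to be matched with the negative ones at distances below
any given `ε`. Quasiconvexity joins matched points by curves of length at most a constant times `ε`,
and integration along these `N` curves is an integral 1-current with the right boundary and mass at
most the total length (`fillvol_le_of_curves`).

The matching lemma is proved by contradiction along an ultrafilter. The `2N` point sequences are
grouped by asymptotic coincidence. If no matching exists, some group has unequal numbers of positive
and negative points, and a single bounded Lipschitz bump isolates it for infinitely many `m`, giving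
a fixed nonzero integer as value. When the group does not converge, completeness keeps it away from
every point, so a sparse subsequence can carry infinitely many separated bumps at once.

That curves give integral currents rests on one-dimensional calculus. `integral_comp_mul_deriv_comp`
pushes an interval forward to an oriented interval, and summing over the components of an open set
yields the integer multiplicity (`exists_multiplicity`). The derivative of the total variation
bounds the mass by the length (`exists_speed`), and `ae_deriv_comp_eq_zero` makes the mass vanish on
`ℋ¹`-null sets. -/

theorem lipB_continuous (f : LipB X) : Continuous (f : X → ℝ) := by
  obtain ⟨⟨K, hK⟩, -⟩ := f.2
  exact hK.continuous

theorem lipB_exists_bound (f : LipB X) : ∃ M : ℝ, ∀ x, |(f : X → ℝ) x| ≤ M := f.2.2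

/-! ### Density of bounded Lipschitz functions in `L^p` -/

section Density

variable [MeasurableSpace X] [BorelSpace X]

theorem lipB_memLp (f : LipB X) (p : ℝ≥0∞) (μ : Measure X) [IsFiniteMeasure μ] :
    MemLp (f : X → ℝ) p μ := by
  obtain ⟨M, hM⟩ := lipB_exists_bound f
  exact MemLp.of_bound (lipB_continuous f).aestronglyMeasurable M (Eventually.of_forall hM)

theorem lipB_integrable (f : LipB X) (μ : Measure X) [IsFiniteMeasure μ] :
    Integrable (f : X → ℝ) μ :=
  memLp_one_iff_integrable.1 (lipB_memLp f 1 μ)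

/-- Bounded Lipschitz functions are dense in `L^p` of a finite Borel measure. -/
theorem exists_lipB_eLpNorm_sub_le (μ : Measure X) [IsFiniteMeasure μ] {p : ℝ≥0∞} (hp : p ≠ ∞)
    {g : X → ℝ} (hg : MemLp g p μ) {ε : ℝ≥0∞} (hε : ε ≠ 0) :
    ∃ f : LipB X, eLpNorm (g - (f : X → ℝ)) p μ ≤ ε := by
  suffices h : ∃ f : X → ℝ, eLpNorm (g - f) p μ ≤ ε ∧ f ∈ LipB X by
    obtain ⟨f, hf, hf'⟩ := h
    exact ⟨⟨f, hf'⟩, hf⟩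
  refine MemLp.induction_dense hp (fun f => f ∈ LipB X) ?_ (fun f g hf hg => add_mem hf hg)
    (fun f hf => (lipB_continuous ⟨f, hf⟩).aestronglyMeasurable) hg hε
  intro c s hs _ ε hε
  obtain ⟨η, hη, hηs⟩ := exists_eLpNorm_indicator_le (μ := μ) hp c hε
  have hη2 : (η / 2 : ℝ≥0∞) ≠ 0 := by simp [hη.ne']
  obtain ⟨F, hFs, hFc, hF⟩ := hs.exists_isClosed_sdiff_lt (measure_ne_top μ s) hη2
  have ht := tendsto_measure_thickening_of_isClosed (μ := μ) (s := F)
    ⟨1, one_pos, measure_ne_top μ _⟩ hFc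
  have hlt : μ F < μ F + η / 2 := ENNReal.lt_add_right (measure_ne_top μ F) hη2
  obtain ⟨r, hr, hr0⟩ :=
    ((ht.eventually (gt_mem_nhds hlt)).and self_mem_nhdsWithin).exists
  have hr0 : 0 < r := hr0
  set t := thickenedIndicator hr0 F
  -- Off this set the multiple `c` of the thickened indicator of `F` agrees with `c` times the
  -- indicator of `s`, and on it the two differ by at most `|c|`.
  have hbig : μ ((Metric.thickening r F \ F) ∪ (s \ F)) ≤ η := by
    refine (measure_union_le _ _).trans ?_
    have h1 : μ (Metric.thickening r F \ F) ≤ η / 2 := by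
      rw [measure_sdiff (Metric.self_subset_thickening hr0 F) hFc.measurableSet.nullMeasurableSet
        (measure_ne_top μ F)]
      exact tsub_le_iff_left.2 hr.le
    calc _ ≤ (η / 2 + η / 2 : ℝ≥0∞) := add_le_add h1 hF.le
      _ = η := ENNReal.add_halves _
  refine ⟨fun x => c * (t x : ℝ), (eLpNorm_mono fun x => ?_).trans (hηs _ hbig), ?_⟩
  · have ht1 : (t x : ℝ) ≤ 1 := by exact_mod_cast thickenedIndicator_le_one hr0 F x
    have ht0 : (0 : ℝ) ≤ t x := (t x).2
    by_cases hxF : x ∈ F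
    · have h1 : t x = 1 := thickenedIndicator_one hr0 F hxF
      simp [hFs hxF, h1]
    by_cases hxt : x ∈ Metric.thickening r F
    · have : x ∈ (Metric.thickening r F \ F) ∪ (s \ F) := Or.inl ⟨hxt, hxF⟩
      rw [indicator_of_mem this]
      by_cases hxs : x ∈ s
      · simp only [Pi.sub_apply, indicator_of_mem hxs, Real.norm_eq_abs]
        rw [show c * (t x : ℝ) - c = c * ((t x : ℝ) - 1) by ring, abs_mul]
        refine mul_le_of_le_one_right (abs_nonneg c) ?_
        rw [abs_le]; constructor <;> linarith
      · simp only [Pi.sub_apply, indicator_of_notMem hxs, Real.norm_eq_abs, sub_zero, abs_mul]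
        refine mul_le_of_le_one_right (abs_nonneg c) ?_
        rw [abs_le]; constructor <;> linarith
    · have h0 : t x = 0 := thickenedIndicator_zero hr0 F hxt
      by_cases hxs : x ∈ s
      · have : x ∈ (Metric.thickening r F \ F) ∪ (s \ F) := Or.inr ⟨hxs, hxF⟩
        simp [indicator_of_mem this, hxs, h0]
      · simp [hxs, h0]
  · refine (LipB X).smul_mem c (x := fun x => (t x : ℝ)) ⟨⟨r.toNNReal⁻¹, ?_⟩, 1, fun x => ?_⟩
    · exact lipschitzWith_thickenedIndicator hr0 F
    · change |(t x : ℝ)| ≤ 1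
      rw [abs_of_nonneg (NNReal.coe_nonneg _)]
      exact_mod_cast thickenedIndicator_le_one hr0 F x

end Density

theorem integral_abs_eq_toReal_eLpNorm {α : Type*} [MeasurableSpace α] {μ : Measure α}
    {g : α → ℝ} (hg : AEStronglyMeasurable g μ) :
    ∫ x, |g x| ∂μ = (eLpNorm g 1 μ).toReal := by
  rw [eLpNorm_one_eq_lintegral_enorm, ← integral_norm_eq_lintegral_enorm hg]
  rfl

theorem integral_abs_le_L2 {α : Type*} [MeasurableSpace α] {μ : Measure α} [IsFiniteMeasure μ]
    {g : α → ℝ} (hg : MemLp g 2 μ) :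
    ∫ x, |g x| ∂μ ≤ (eLpNorm g 2 μ).toReal * (μ univ ^ (1 / 2 : ℝ)).toReal := by
  rw [integral_abs_eq_toReal_eLpNorm hg.1, ← ENNReal.toReal_mul]
  have h := eLpNorm_le_eLpNorm_mul_rpow_measure_univ (p := 1) (q := 2) one_le_two hg.1
  have e : (1 / (1 : ℝ≥0∞).toReal - 1 / (2 : ℝ≥0∞).toReal) = (1 / 2 : ℝ) := by norm_num
  rw [e] at h
  refine ENNReal.toReal_mono (ENNReal.mul_ne_top hg.2.ne ?_) h
  exact ENNReal.rpow_ne_top_of_nonneg (by norm_num) (measure_ne_top μ univ)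

theorem inner_toLp {α : Type*} [MeasurableSpace α] {μ : Measure α} {g ρ : α → ℝ}
    (hg : MemLp g 2 μ) (hρ : MemLp ρ 2 μ) :
    inner ℝ (hρ.toLp ρ) (hg.toLp g) = ∫ x, g x * ρ x ∂μ := by
  rw [L2.inner_def]
  refine integral_congr_ae ?_
  filter_upwards [hg.coeFn_toLp, hρ.coeFn_toLp] with x h1 h2
  rw [h1, h2]
  simp

theorem abs_integral_mul_le_L2 {α : Type*} [MeasurableSpace α] {μ : Measure α} {g ρ : α → ℝ}
    (hg : MemLp g 2 μ) (hρ : MemLp ρ 2 μ) :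
    |∫ x, g x * ρ x ∂μ| ≤ (eLpNorm ρ 2 μ).toReal * (eLpNorm g 2 μ).toReal := by
  rw [← inner_toLp hg hρ, ← Lp.norm_toLp g hg, ← Lp.norm_toLp ρ hρ]
  exact abs_real_inner_le_norm _ _

/-! ### The mass measure controls the functional -/

section MassMeasure

variable [MeasurableSpace X] {k : ℕ}

theorem massMeasure_le {T : Functional X k} {μ : Measure X} [IsFiniteMeasure μ]
    (h : Controls T μ) : massMeasure T ≤ μ :=
  sInf_le ⟨inferInstance, h⟩

theorem isFiniteMeasure_massMeasure {T : Functional X k} (h : HasFiniteMass T) :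
    IsFiniteMeasure (massMeasure T) := by
  obtain ⟨μ, hμ, hT⟩ := h
  exact isFiniteMeasure_of_le μ (massMeasure_le hT)

variable [BorelSpace X]

/-- The image of a bounded Lipschitz function in `L²`. -/
def lipBToL2 (μ : Measure X) [IsFiniteMeasure μ] : LipB X →ₗ[ℝ] Lp ℝ 2 μ where
  toFun f := (lipB_memLp f 2 μ).toLp _
  map_add' _ _ := rfl
  map_smul' _ _ := rfl

theorem denseRange_lipBToL2 (μ : Measure X) [IsFiniteMeasure μ] :
    DenseRange (lipBToL2 μ) := by
  intro g
  refine EMetric.mem_closure_iff.2 fun ε hε => ?_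
  obtain ⟨δ, hδ, hδε⟩ := exists_between hε
  obtain ⟨f, hf⟩ := exists_lipB_eLpNorm_sub_le μ ENNReal.ofNat_ne_top (Lp.memLp g) hδ.ne'
  refine ⟨_, mem_range_self f, lt_of_le_of_lt ?_ hδε⟩
  rw [← Lp.toLp_coeFn g (Lp.memLp g)]
  exact (Lp.edist_toLp_toLp _ _ (Lp.memLp g) (lipB_memLp f 2 μ)).trans_le hf

/-- A functional which is bounded in `L¹(μ)` on bounded Lipschitz functions has a density in
`L²(μ)`. -/
theorem exists_density (μ : Measure X) [IsFiniteMeasure μ] (ℓ : LipB X →ₗ[ℝ] ℝ) {c : ℝ}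
    (hc : 0 ≤ c) (hℓ : ∀ f, |ℓ f| ≤ c * ∫ x, |(f : X → ℝ) x| ∂μ) :
    ∃ ρ : X → ℝ, MemLp ρ 2 μ ∧ ∀ f : LipB X, ℓ f = ∫ x, (f : X → ℝ) x * ρ x ∂μ := by
  -- On a finite measure space an `L¹` bound implies an `L²` bound, so the functional extends to the
  -- Hilbert space `L²` and the Riesz representation provides the density.
  have hb : ∀ f, ‖ℓ f‖ ≤ (c * (μ univ ^ (1 / 2 : ℝ)).toReal) * ‖lipBToL2 μ f‖ := by
    intro f
    refine (hℓ f).trans ?_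
    rw [mul_assoc]
    refine mul_le_mul_of_nonneg_left ?_ hc
    refine (integral_abs_le_L2 (lipB_memLp f 2 μ)).trans_eq ?_
    rw [mul_comm, lipBToL2]
    exact congrArg _ (Lp.norm_toLp _ (lipB_memLp f 2 μ)).symm
  set L := ℓ.extendOfNorm (lipBToL2 μ)
  set r : Lp ℝ 2 μ := (InnerProductSpace.toDual ℝ (Lp ℝ 2 μ)).symm L
  refine ⟨r, Lp.memLp r, fun f => ?_⟩
  rw [← LinearMap.extendOfNorm_eq (denseRange_lipBToL2 μ) ⟨_, hb⟩ f,
    ← inner_toLp (lipB_memLp f 2 μ) (Lp.memLp r), Lp.toLp_coeFn]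
  exact (InnerProductSpace.toDual_symm_apply (𝕜 := ℝ) (y := L) (x := lipBToL2 μ f)).symm

/-- Test with bounded Lipschitz approximations of `sign(ρ)` times the indicator of `A`.
Approximating in `L²(μ₀ + μ)` makes them close for both measures at once, so a bound involving `μ`
transfers to the density taken with respect to `μ₀`. -/
theorem integral_abs_density_le {μ₀ μ : Measure X} [IsFiniteMeasure μ₀] [IsFiniteMeasure μ]
    {ρ : X → ℝ} (hρ : MemLp ρ 2 μ₀) {c : ℝ} (hc : 0 ≤ c)
    (h : ∀ f : LipB X, |∫ x, (f : X → ℝ) x * ρ x ∂μ₀| ≤ c * ∫ x, |(f : X → ℝ) x| ∂μ)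
    {A : Set X} (hA : MeasurableSet A) : ∫ x in A, |ρ x| ∂μ₀ ≤ c * μ.real A := by
  obtain ⟨ρ', hρ'm, hρρ'⟩ := hρ.1
  set s : X → ℝ := A.indicator fun x => (SignType.sign (ρ' x) : ℝ)
  have hs1 : ∀ x, |s x| ≤ A.indicator (fun _ => (1 : ℝ)) x := by
    intro x
    by_cases hx : x ∈ A
    · simp only [s, indicator_of_mem hx]
      rcases lt_trichotomy (ρ' x) 0 with h | h | h <;> simp [h]
    · simp [s, hx]
  have hsm : Measurable s := by
    refine Measurable.indicator ?_ hA
    have : Measurable fun y : ℝ => (SignType.sign y : ℝ) := by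
      have : (fun y : ℝ => (SignType.sign y : ℝ)) =
          fun y => if 0 < y then 1 else if y < 0 then -1 else 0 := by
        funext y
        rcases lt_trichotomy y 0 with h | h | h <;> simp [h, not_lt.2 h.le]
      rw [this]
      exact Measurable.ite measurableSet_Ioi measurable_const
        (Measurable.ite measurableSet_Iio measurable_const measurable_const)
    exact this.comp hρ'm.measurable
  have hsb : ∀ x, |s x| ≤ 1 := fun x => (hs1 x).trans (indicator_le_self' (by simp) x)
  have hsL : MemLp s 2 (μ₀ + μ) :=
    MemLp.of_bound hsm.aestronglyMeasurable 1 (Eventually.of_forall hsb)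
  have hL : ∫ x in A, |ρ x| ∂μ₀ = ∫ x, s x * ρ x ∂μ₀ := by
    rw [← integral_indicator hA]
    refine integral_congr_ae ?_
    filter_upwards [hρρ'] with x hx
    by_cases hxA : x ∈ A
    · simp only [s, indicator_of_mem hxA, hx]
      exact (sign_mul_self _).symm
    · simp [s, hxA]
  set R := (eLpNorm ρ 2 μ₀).toReal
  set M := (μ univ ^ (1 / 2 : ℝ)).toReal
  have hR : 0 ≤ R := ENNReal.toReal_nonneg
  have hM : 0 ≤ M := ENNReal.toReal_nonneg
  rw [hL]
  have key : ∀ ε : ℝ, 0 < ε → ∫ x, s x * ρ x ∂μ₀ ≤ c * μ.real A + (R + c * M) * ε := by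
    intro ε hε
    obtain ⟨f, hf⟩ := exists_lipB_eLpNorm_sub_le (μ₀ + μ) ENNReal.ofNat_ne_top hsL
      (ENNReal.ofReal_pos.2 hε).ne'
    have hs0 : MemLp s 2 μ₀ := hsL.mono_measure (Measure.le_add_right le_rfl)
    have hs' : MemLp s 2 μ := hsL.mono_measure (Measure.le_add_left le_rfl)
    have hd0 : MemLp (s - (f : X → ℝ)) 2 μ₀ := hs0.sub (lipB_memLp f 2 μ₀)
    have hd' : MemLp (s - (f : X → ℝ)) 2 μ := hs'.sub (lipB_memLp f 2 μ)
    have e0 : (eLpNorm (s - (f : X → ℝ)) 2 μ₀).toReal ≤ ε :=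
      ENNReal.toReal_le_of_le_ofReal hε.le
        ((eLpNorm_mono_measure _ (Measure.le_add_right le_rfl)).trans hf)
    have e' : (eLpNorm (s - (f : X → ℝ)) 2 μ).toReal ≤ ε :=
      ENNReal.toReal_le_of_le_ofReal hε.le
        ((eLpNorm_mono_measure _ (Measure.le_add_left le_rfl)).trans hf)
    have h1 : ∫ x, s x * ρ x ∂μ₀ =
        ∫ x, (s - (f : X → ℝ)) x * ρ x ∂μ₀ + ∫ x, (f : X → ℝ) x * ρ x ∂μ₀ := by
      refine Eq.trans ?_
        (integral_add (hd0.integrable_mul hρ) ((lipB_memLp f 2 μ₀).integrable_mul hρ))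
      refine integral_congr_ae (Eventually.of_forall fun x => ?_)
      simp only [Pi.sub_apply]; ring
    have h2 : ∫ x, |(f : X → ℝ) x| ∂μ ≤ μ.real A + M * ε := by
      have : ∫ x, |(f : X → ℝ) x| ∂μ ≤
          ∫ x, (A.indicator (fun _ => (1 : ℝ)) x + |(s - (f : X → ℝ)) x|) ∂μ := by
        refine integral_mono (lipB_integrable f μ).abs ?_ fun x => ?_
        · exact ((integrable_const 1).indicator hA).add (hd'.integrable one_le_two).abs
        · have := abs_sub_abs_le_abs_sub ((f : X → ℝ) x) (s x)
          rw [abs_sub_comm] at this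
          have := hs1 x
          simp only [Pi.sub_apply]
          linarith
      refine this.trans ?_
      rw [integral_add ((integrable_const 1).indicator hA) (hd'.integrable one_le_two).abs,
        integral_indicator hA]
      simp only [integral_const, smul_eq_mul, mul_one, MeasurableSet.univ, measureReal_restrict_apply, univ_inter]
      have := integral_abs_le_L2 hd'
      have := mul_le_mul_of_nonneg_right e' hM
      linarith
    have h3 := (le_abs_self _).trans (h f)
    have h4 := (le_abs_self _).trans (abs_integral_mul_le_L2 hd0 hρ)
    have h5 := mul_le_mul_of_nonneg_left e0 hR
    have h6 := mul_le_mul_of_nonneg_left h2 hc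
    rw [h1]
    nlinarith
  refine le_of_forall_pos_le_add fun ε hε => ?_
  have hpos : 0 < R + c * M + 1 := by positivity
  refine (key (ε / (R + c * M + 1)) (by positivity)).trans ?_
  gcongr
  rw [mul_div_assoc', div_le_iff₀ hpos]
  nlinarith

/-- The mass measure of a functional of finite mass controls the functional. -/
theorem controls_massMeasure {T : Functional X k} (hT : HasFiniteMass T) :
    Controls T (massMeasure T) := by
  intro f π K hK
  have hfin := isFiniteMeasure_massMeasure hT
  obtain ⟨μ₀, hμ₀, hT₀⟩ := hT
  set c : ℝ := ∏ i, (K i : ℝ)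
  have hc : 0 ≤ c := Finset.prod_nonneg fun i _ => (K i).2
  let ℓ : LipB X →ₗ[ℝ] ℝ :=
    { toFun := fun f => T f π
      map_add' := fun f g => by simp
      map_smul' := fun a f => by simp }
  obtain ⟨ρ, hρ, hℓ⟩ := exists_density μ₀ ℓ hc (fun f => hT₀ f π K hK)
  have hρi : Integrable ρ μ₀ := hρ.integrable one_le_two
  rcases hc.eq_or_lt with hc0 | hc0
  · have := hT₀ f π K hK
    change _ ≤ c * _ at this
    rwa [← hc0, zero_mul] at this ⊢
  -- This is the least measure that can control `T(·, π)` for this one `π`; it lies below each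
  -- controlling measure of `T`, hence below the infimum.
  set ν : Measure X := (ENNReal.ofReal c)⁻¹ • μ₀.withDensity fun x => ‖ρ x‖ₑ
  have hν : ν ≤ massMeasure T := by
    refine le_sInf fun μ hμ => ?_
    obtain ⟨hμf, hμ⟩ := hμ
    refine Measure.le_iff.2 fun A hA => ?_
    have h := integral_abs_density_le hρ hc
      (fun f => (hℓ f ▸ hμ f π K hK : |∫ x, (f : X → ℝ) x * ρ x ∂μ₀| ≤ _)) hA
    have h2 : ∫⁻ x in A, ‖ρ x‖ₑ ∂μ₀ ≤ ENNReal.ofReal c * μ A := by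
      have e : ∫⁻ x in A, ‖ρ x‖ₑ ∂μ₀ = ENNReal.ofReal (∫ x in A, |ρ x| ∂μ₀) :=
        (ofReal_integral_norm_eq_lintegral_enorm hρi.restrict).symm
      rw [e]
      refine (ENNReal.ofReal_le_ofReal h).trans_eq ?_
      rw [ENNReal.ofReal_mul hc, ofReal_measureReal]
    rw [Measure.smul_apply, withDensity_apply _ hA, smul_eq_mul, ENNReal.inv_mul_le_iff
      (ENNReal.ofReal_pos.2 hc0).ne' ENNReal.ofReal_ne_top]
    exact h2
  have h1 : ENNReal.ofReal |T f π| ≤ ENNReal.ofReal c * ∫⁻ x, ‖(f : X → ℝ) x‖ₑ ∂ν := by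
    have : T f π = ∫ x, (f : X → ℝ) x * ρ x ∂μ₀ := hℓ f
    rw [this, ← Real.enorm_eq_ofReal_abs]
    refine (enorm_integral_le_lintegral_enorm _).trans_eq ?_
    simp only [ν, lintegral_smul_measure, smul_eq_mul]
    rw [← mul_assoc, ENNReal.mul_inv_cancel (ENNReal.ofReal_pos.2 hc0).ne' ENNReal.ofReal_ne_top,
      one_mul, lintegral_withDensity_eq_lintegral_mul₀ hρ.1.aemeasurable.enorm
        (lipB_continuous f).measurable.enorm.aemeasurable]
    simp [mul_comm]
  have h2 : ∫⁻ x, ‖(f : X → ℝ) x‖ₑ ∂ν ≤ ENNReal.ofReal (∫ x, |(f : X → ℝ) x| ∂massMeasure T) := by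
    refine (lintegral_mono' hν le_rfl).trans_eq ?_
    exact (ofReal_integral_norm_eq_lintegral_enorm (lipB_integrable f _)).symm
  have h3 := h1.trans (mul_le_mul_right h2 _)
  rw [← ENNReal.ofReal_mul hc] at h3
  exact (ENNReal.ofReal_le_ofReal_iff (mul_nonneg hc (integral_nonneg fun _ => abs_nonneg _))).1 h3

end MassMeasure

/-! ### Zero-dimensional integral currents and the easy implication -/

section ZeroDimensional

/-- Values in `[-1, 1]` on a finite set are attained by a Lipschitz function with values in
`[-1, 1]`. -/
theorem exists_lipB_eqOn_finset (s : Finset X) (σ : X → ℝ) (hσ : ∀ x, |σ x| ≤ 1) :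
    ∃ f : LipB X, (∀ x ∈ s, (f : X → ℝ) x = σ x) ∧ ∀ x, |(f : X → ℝ) x| ≤ 1 := by
  have hev : ∀ᶠ r : ℝ in 𝓝[>] 0, ∀ p ∈ (s : Set X).offDiag, r < dist p.1 p.2 := by
    refine (eventually_all_finite s.finite_toSet.offDiag).2 fun p hp => ?_
    exact nhdsWithin_le_nhds (gt_mem_nhds (dist_pos.2 hp.2.2))
  obtain ⟨r, hr, hr0⟩ := (hev.and self_mem_nhdsWithin).exists
  have hr0 : 0 < r := hr0
  -- Distinct points of `s` are more than `r` apart while `σ` oscillates by at most 2.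
  have hl : LipschitzOnWith (2 / r.toNNReal) σ s := by
    refine LipschitzOnWith.of_dist_le_mul fun x hx y hy => ?_
    rcases eq_or_ne x y with rfl | hxy
    · simp
    have h1 : r < dist x y := hr (x, y) ⟨hx, hy, hxy⟩
    have h2 : dist (σ x) (σ y) ≤ 2 := by
      rw [Real.dist_eq]
      have := abs_sub (σ x) (σ y)
      linarith [hσ x, hσ y]
    refine h2.trans ?_
    push_cast
    rw [Real.coe_toNNReal r hr0.le, div_mul_eq_mul_div, le_div_iff₀ hr0]
    linarith
  obtain ⟨g, hg, hgs⟩ := hl.extend_real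
  refine ⟨⟨fun x => max (min (g x) 1) (-1), ⟨_, (hg.min_const 1).max_const (-1)⟩, 1, ?_⟩, ?_, ?_⟩
  · intro x
    rw [abs_le]
    exact ⟨le_max_right _ _, max_le (min_le_right _ _) (by norm_num)⟩
  · intro x hx
    have := abs_le.1 (hσ x)
    change max (min (g x) 1) (-1) = σ x
    rw [← hgs hx, min_eq_left this.2, max_eq_left this.1]
  · intro x
    change |max (min (g x) 1) (-1)| ≤ 1
    rw [abs_le]
    exact ⟨le_max_right _ _, max_le (min_le_right _ _) (by norm_num)⟩

/-- A countable integer combination of point evaluations that converges on the constant function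
`1` is a finite one. -/
theorem IsIntegerRectifiableZero.exists_finsupp {T : Functional X 0}
    (hT : IsIntegerRectifiableZero T) :
    ∃ c : X →₀ ℤ, ∀ (f : LipB X) (π : Fin 0 → Lip X),
      T f π = c.sum fun x n => (n : ℝ) * (f : X → ℝ) x := by
  obtain ⟨ι, _, θ, x, h⟩ := hT
  have hs : Summable fun i => (θ i : ℝ) := by
    have := (h (LipB.one X) Fin.elim0).summable
    simpa [LipB.one] using this
  have hfin : {i | θ i ≠ 0}.Finite := by
    have := hs.tendsto_cofinite_zero
    have h2 : ∀ᶠ i in cofinite, |(θ i : ℝ)| < 1 := by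
      simpa [Real.dist_eq] using (Metric.tendsto_nhds.1 this) 1 one_pos
    refine Set.Finite.subset h2 fun i hi hlt => hi ?_
    have : |θ i| < 1 := by exact_mod_cast hlt
    exact Int.abs_lt_one_iff.1 this
  refine ⟨∑ i ∈ hfin.toFinset, Finsupp.single (x i) (θ i), fun f π => ?_⟩
  rw [← Finsupp.sum_finsetSum_index (by simp) (by intros; push_cast; ring)]
  simp only [Finsupp.sum_single_index, Int.cast_zero, zero_mul]
  refine (h f π).unique (hasSum_sum_of_ne_finset_zero fun i hi => ?_)
  have : θ i = 0 := by simpa using hi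
  simp [this]

variable [MeasurableSpace X] [BorelSpace X]

/-- Evaluate on a Lipschitz function that is bounded by 1 and equals the sign of the coefficient at
each point of the support. -/
theorem natAbs_sum_le_mass {T : Functional X 0} (hT : HasFiniteMass T) {c : X →₀ ℤ}
    (hc : ∀ (f : LipB X) (π : Fin 0 → Lip X),
      T f π = c.sum fun x n => (n : ℝ) * (f : X → ℝ) x) :
    ((c.sum fun _ n => n.natAbs : ℕ) : ℝ≥0∞) ≤ mass T := by
  have hfin := isFiniteMeasure_massMeasure hT
  obtain ⟨f, hf, hf1⟩ := exists_lipB_eqOn_finset c.support (fun x => ((c x).sign : ℝ)) (by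
    intro x
    rcases lt_trichotomy (c x) 0 with h | h | h
    · simp [Int.sign_eq_neg_one_of_neg h]
    · simp [h]
    · simp [Int.sign_eq_one_of_pos h])
  have h := controls_massMeasure hT f Fin.elim0 Fin.elim0 fun i => i.elim0
  have h2 : ∫ x, |(f : X → ℝ) x| ∂massMeasure T ≤ (massMeasure T).real univ := by
    refine (integral_mono (lipB_integrable f _).abs (integrable_const 1) hf1).trans_eq ?_
    simp
  have h3 : T f Fin.elim0 = ((c.sum fun _ n => n.natAbs : ℕ) : ℝ) := by
    rw [hc, Finsupp.sum, Finsupp.sum, Nat.cast_sum]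
    refine Finset.sum_congr rfl fun x hx => ?_
    rw [hf x hx, Nat.cast_natAbs, ← Int.cast_mul, mul_comm, Int.sign_mul_self_eq_abs]
  simp only [Finset.univ_eq_empty, Finset.prod_empty, one_mul, h3, Nat.abs_cast] at h
  have h4 := h.trans h2
  rw [mass, ← ofReal_measureReal (μ := massMeasure T), ← ENNReal.ofReal_natCast]
  exact ENNReal.ofReal_le_ofReal h4

/-- Each filling `V` gives `S(f) = V(1, f)`, bounded by the Lipschitz constant times the mass. The
constant is `K + 1` because `K = 0` would fail when there is no filling: then `0 * ∞ = 0`, while `S`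
need not vanish on constants. -/
theorem ofReal_abs_le_mul_fillvol (S : Functional X 0) (f : LipB X) {K : ℝ≥0}
    (hK : LipschitzWith K (f : X → ℝ)) (π : Fin 0 → Lip X) :
    ENNReal.ofReal |S f π| ≤ (K + 1 : ℝ≥0) * fillvol S := by
  have hK0 : ((K + 1 : ℝ≥0) : ℝ≥0∞) ≠ 0 := by positivity
  rw [← ENNReal.div_le_iff' hK0 ENNReal.coe_ne_top]
  refine le_iInf₂ fun V hV => ?_
  obtain ⟨⟨hV, -, -⟩, hVS⟩ := hV
  rw [ENNReal.div_le_iff' hK0 ENNReal.coe_ne_top]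
  have hfin := isFiniteMeasure_massMeasure hV.finiteMass
  have h := controls_massMeasure hV.finiteMass (LipB.one X)
    (Fin.cons (Submodule.inclusion (lipB_le_lip X) f) π) (fun _ => K + 1) (by
      intro i
      refine Fin.cases ?_ (fun j => j.elim0) i
      exact hK.weaken (by simp))
  rw [← boundary_apply, hVS] at h
  simp only [LipB.one, Finset.prod_const, Finset.card_univ, Fintype.card_fin, zero_add, pow_one,
    abs_one, integral_const, smul_eq_mul, mul_one] at h
  refine (ENNReal.ofReal_le_ofReal h).trans_eq ?_
  rw [ENNReal.ofReal_mul (NNReal.coe_nonneg _), ENNReal.ofReal_coe_nnreal, ofReal_measureReal, mass]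

theorem weaklyConverges_of_tendsto_fillvol {T : Functional X 0} {Tm : ℕ → Functional X 0}
    (h : Tendsto (fun m => fillvol (T - Tm m)) atTop (𝓝 0)) : WeaklyConverges Tm T := by
  intro f π
  obtain ⟨⟨K, hK⟩, -⟩ := f.2
  have h1 : Tendsto (fun m => ((K + 1 : ℝ≥0) : ℝ≥0∞) * fillvol (T - Tm m)) atTop (𝓝 0) := by
    have := ENNReal.Tendsto.const_mul (a := ((K + 1 : ℝ≥0) : ℝ≥0∞)) h (Or.inr ENNReal.coe_ne_top)
    rwa [mul_zero] at this
  have h2 : Tendsto (fun m => ENNReal.ofReal |(T - Tm m) f π|) atTop (𝓝 0) :=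
    tendsto_of_tendsto_of_tendsto_of_le_of_le tendsto_const_nhds h1 (fun _ => zero_le)
      fun m => ofReal_abs_le_mul_fillvol (T - Tm m) f hK π
  have h3 : Tendsto (fun m => |(T - Tm m) f π|) atTop (𝓝 0) := by
    have := (ENNReal.tendsto_toReal ENNReal.zero_ne_top).comp h2
    refine this.congr fun m => ?_
    exact ENNReal.toReal_ofReal (abs_nonneg _)
  have h4 := (tendsto_zero_iff_abs_tendsto_zero _).2 h3
  have h5 := (tendsto_const_nhds (x := T f π)).sub h4
  simpa using h5

end ZeroDimensional

/-! ### Weak convergence forces a short matching of points -/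

section Matching

/-- The bump function that is `1` on the `ρ`-neighbourhood of `Z` and `0` off its
`2ρ`-neighbourhood. -/
noncomputable def bump (Z : Set X) (ρ : ℝ) : LipB X :=
  ⟨fun w => max (min (2 - ρ⁻¹ * Metric.infDist w Z) 1) 0, by
    refine ⟨⟨‖ρ⁻¹‖₊, ?_⟩, 1, fun w => ?_⟩
    · have h : LipschitzWith (‖ρ⁻¹‖₊ * 1) fun w => ρ⁻¹ * Metric.infDist w Z :=
        (lipschitzWith_smul ρ⁻¹).comp (Metric.lipschitz_infDist_pt Z)
      have h2 := (LipschitzWith.const (2 : ℝ)).sub h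
      rw [zero_add, mul_one] at h2
      exact (h2.min_const 1).max_const 0
    · rw [abs_of_nonneg (le_max_right _ _)]
      exact max_le (min_le_right _ _) zero_le_one⟩

theorem bump_eq_one {Z : Set X} {ρ : ℝ} (hρ : 0 < ρ) {w z : X} (hz : z ∈ Z) (h : dist w z ≤ ρ) :
    (bump Z ρ : X → ℝ) w = 1 := by
  have h1 : ρ⁻¹ * Metric.infDist w Z ≤ 1 := by
    rw [inv_mul_le_iff₀ hρ, mul_one]
    exact (Metric.infDist_le_dist_of_mem hz).trans h
  change max (min (2 - ρ⁻¹ * Metric.infDist w Z) 1) 0 = 1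
  rw [min_eq_right (by linarith), max_eq_left zero_le_one]

theorem bump_eq_zero {Z : Set X} {ρ : ℝ} (hρ : 0 < ρ) {w : X} (hZ : Z.Nonempty)
    (h : ∀ z ∈ Z, 2 * ρ ≤ dist w z) : (bump Z ρ : X → ℝ) w = 0 := by
  have h1 : 2 ≤ ρ⁻¹ * Metric.infDist w Z := by
    rw [le_inv_mul_iff₀ hρ, mul_comm]
    exact (Metric.le_infDist hZ).2 fun _ hz => h _ hz
  change max (min (2 - ρ⁻¹ * Metric.infDist w Z) 1) 0 = 0
  exact max_eq_right ((min_le_left _ _).trans (by linarith))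

/-- A sequence in a complete space that does not converge along an ultrafilter stays away from
every point. -/
theorem exists_pos_le_dist_of_not_tendsto [CompleteSpace X] (U : Ultrafilter ℕ) {p : ℕ → X}
    (hp : ¬∃ z, Tendsto p U (𝓝 z)) : ∃ ε > 0, ∀ z, ∀ᶠ m in U, ε ≤ dist (p m) z := by
  by_contra! hcon
  refine hp (CompleteSpace.complete (f := map p U) (Metric.cauchy_iff.2 ⟨inferInstance, ?_⟩))
  intro ε hε
  obtain ⟨z, hz⟩ := hcon (ε / 2) (half_pos hε)
  refine ⟨Metric.ball z (ε / 2), ?_, fun a ha b hb => ?_⟩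
  · exact hz
  · have := dist_triangle_right a b z
    rw [Metric.mem_ball] at ha hb
    linarith

theorem exists_perm_of_card_fiber_eq {α β : Type*} [Fintype α] [DecidableEq β] (f g : α → β)
    (h : ∀ a, (Finset.univ.filter fun i => f i = a).card =
      (Finset.univ.filter fun i => g i = a).card) :
    ∃ σ : Equiv.Perm α, ∀ i, g (σ i) = f i := by
  have e : ∀ c, Nonempty ({a // f a = c} ≃ {b // g b = c}) := fun c => by
    refine Fintype.card_eq.1 ?_
    rw [Fintype.card_subtype, Fintype.card_subtype, h]
  exact ⟨Equiv.ofFiberEquiv fun c => (e c).some, fun i => Equiv.ofFiberEquiv_map _ i⟩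

-- If matchings fail infinitely often, pass to an ultrafilter concentrated on the failures, where
-- every distance either tends to 0 or stays bounded below. A class of asymptotically coinciding
-- sequences must contain unequally many `x` and `y`, and a bump equal to 1 on this class and 0 on
-- the other points detects the imbalance.
open Classical in
theorem eventually_exists_perm_dist_lt [CompleteSpace X] {N : ℕ} (x y : ℕ → Fin N → X)
    (h : ∀ f : LipB X,
      Tendsto (fun m => ∑ i, ((f : X → ℝ) (x m i) - (f : X → ℝ) (y m i))) atTop (𝓝 0))
    {ε : ℝ} (hε : 0 < ε) :
    ∀ᶠ m in atTop, ∃ σ : Equiv.Perm (Fin N), ∀ i, dist (x m i) (y m (σ i)) < ε := by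
  by_contra hcon
  rw [not_eventually, frequently_iff_neBot] at hcon
  set U := Ultrafilter.of (atTop ⊓ 𝓟 {m | ¬∃ σ : Equiv.Perm (Fin N),
    ∀ i, dist (x m i) (y m (σ i)) < ε})
  have hU := Ultrafilter.of_le (atTop ⊓ 𝓟 {m | ¬∃ σ : Equiv.Perm (Fin N),
    ∀ i, dist (x m i) (y m (σ i)) < ε})
  have hU1 : (U : Filter ℕ) ≤ atTop := hU.trans inf_le_left
  have hU2 : ∀ᶠ m in U, ¬∃ σ : Equiv.Perm (Fin N), ∀ i, dist (x m i) (y m (σ i)) < ε :=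
    le_principal_iff.1 (hU.trans inf_le_right)
  clear_value U
  let p : Fin N ⊕ Fin N → ℕ → X := Sum.elim (fun i m => x m i) fun i m => y m i
  let R : Setoid (Fin N ⊕ Fin N) :=
    { r := fun a b => Tendsto (fun m => dist (p a m) (p b m)) U (𝓝 0)
      iseqv :=
        { refl := fun a => by simp
          symm := fun {a b} hab => by simpa only [dist_comm] using hab
          trans := fun {a b c} hab hbc => by
            refine squeeze_zero (fun _ => dist_nonneg) (fun m => dist_triangle _ (p b m) _) ?_
            simpa using hab.add hbc } }
  have hR : ∀ a b, R a b ↔ Tendsto (fun m => dist (p a m) (p b m)) U (𝓝 0) := fun _ _ => Iff.rfl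
  -- If every class were balanced, a bijection inside the classes would be a permutation with all
  -- matched distances tending to 0 along `U`.
  have hbal : ∃ a, (Finset.univ.filter fun i => R a (.inl i)).card ≠
      (Finset.univ.filter fun i => R a (.inr i)).card := by
    by_contra! hall
    obtain ⟨σ, hσ⟩ := exists_perm_of_card_fiber_eq
      (fun i : Fin N => (Quotient.mk R (.inl i))) (fun i => Quotient.mk R (.inr i)) (by
        intro c
        induction c using Quotient.inductionOn with
        | h a =>
          simp only [Quotient.eq]
          have := hall a
          simpa only [R.comm'] using this)
    have : ∀ᶠ m in U, ∀ i, dist (x m i) (y m (σ i)) < ε := by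
      refine eventually_all.2 fun i => ?_
      have hi : R (.inl i) (.inr (σ i)) := (Quotient.eq.1 (hσ i).symm)
      exact ((hR _ _).1 hi).eventually (gt_mem_nhds hε)
    obtain ⟨m, hm1, hm2⟩ := (this.and hU2).exists
    exact hm2 ⟨σ, hm1⟩
  obtain ⟨a, ha⟩ := hbal
  have hsep : ∃ r > 0, ∀ᶠ m in U, ∀ b, ¬R a b → r ≤ dist (p a m) (p b m) := by
    have : ∀ᶠ r in 𝓝[>] (0 : ℝ), ∀ b, ∀ᶠ m in U, ¬R a b → r ≤ dist (p a m) (p b m) := by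
      refine eventually_all.2 fun b => ?_
      by_cases hab : R a b
      · simp [hab]
      have hab' := hab
      rw [hR, Metric.tendsto_nhds] at hab'
      push Not at hab'
      obtain ⟨r₀, hr₀, hr⟩ := hab'
      filter_upwards [nhdsWithin_le_nhds (gt_mem_nhds hr₀)] with r hrr
      filter_upwards [hr] with m hm _
      rw [Real.dist_eq, sub_zero, abs_of_nonneg dist_nonneg] at hm
      linarith
    obtain ⟨r, hr, hr0⟩ := (this.and self_mem_nhdsWithin).exists
    exact ⟨r, hr0, eventually_all.2 hr⟩
  obtain ⟨r, hr0, hr⟩ := hsep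
  have hclose : ∀ ρ > 0, ∀ᶠ m in U, ∀ b, R a b → dist (p b m) (p a m) < ρ := by
    intro ρ hρ
    refine eventually_all.2 fun b => ?_
    by_cases hab : R a b
    · have := ((hR _ _).1 hab).eventually (gt_mem_nhds hρ)
      filter_upwards [this] with m hm _
      rwa [dist_comm]
    · simp [hab]
  -- It suffices to find a bump function which isolates the class of `a`.
  suffices hZ : ∃ (Z : Set X) (ρ : ℝ), 0 < ρ ∧ Z.Nonempty ∧ ∃ᶠ m in atTop, ∀ b,
      (R a b → ∃ z ∈ Z, dist (p b m) z ≤ ρ) ∧ (¬R a b → ∀ z ∈ Z, 2 * ρ ≤ dist (p b m) z) by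
    obtain ⟨Z, ρ, hρ, hZ, hfr⟩ := hZ
    -- The sum tested against the bump equals this nonzero integer for infinitely many `m`, so it
    -- cannot tend to 0.
    set k : ℤ := (Finset.univ.filter fun i => R a (.inl i)).card -
      (Finset.univ.filter fun i => R a (.inr i)).card with hk
    have hk0 : k ≠ 0 := by
      rw [hk, sub_ne_zero]
      exact_mod_cast ha
    have hk1 : (1 : ℝ) ≤ |(k : ℝ)| := by exact_mod_cast Int.one_le_abs hk0
    have hlt := (Metric.tendsto_nhds.1 (h (bump Z ρ))) 1 one_pos
    obtain ⟨m, hm, hm'⟩ := (hfr.and_eventually hlt).exists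
    have hval : ∀ b, (bump Z ρ : X → ℝ) (p b m) = if R a b then 1 else 0 := by
      intro b
      by_cases hab : R a b
      · obtain ⟨z, hz, hzd⟩ := (hm b).1 hab
        rw [if_pos hab, bump_eq_one hρ hz hzd]
      · rw [if_neg hab, bump_eq_zero hρ hZ ((hm b).2 hab)]
    have hsum : ∑ i, ((bump Z ρ : X → ℝ) (x m i) - (bump Z ρ : X → ℝ) (y m i)) = k := by
      rw [Finset.sum_sub_distrib]
      have e1 : ∀ i, (bump Z ρ : X → ℝ) (x m i) = if R a (.inl i) then 1 else 0 :=
        fun i => hval (.inl i)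
      have e2 : ∀ i, (bump Z ρ : X → ℝ) (y m i) = if R a (.inr i) then 1 else 0 :=
        fun i => hval (.inr i)
      simp only [e1, e2, Finset.sum_boole, hk]
      push_cast
      rfl
    rw [hsum, Real.dist_eq, sub_zero] at hm'
    linarith
  by_cases hconv : ∃ z, Tendsto (p a) U (𝓝 z)
  · obtain ⟨z, hz⟩ := hconv
    -- The class lies within `r/8 + r/8` of the limit `z`, all other points at least `r - r/8` away,
    -- which exceeds `2 * (r/4)`.
    refine ⟨{z}, r / 4, by positivity, singleton_nonempty z, ?_⟩
    refine Frequently.filter_mono (f := (U : Filter ℕ)) (Eventually.frequently ?_) hU1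
    have hz' : ∀ᶠ m in U, dist (p a m) z < r / 8 := hz.eventually (Metric.ball_mem_nhds z (by positivity))
    filter_upwards [hr, hclose (r / 8) (by positivity), hz'] with m h1 h2 h3 b
    refine ⟨fun hab => ⟨z, rfl, ?_⟩, ?_⟩
    · have := dist_triangle (p b m) (p a m) z
      linarith [h2 b hab]
    · intro hab w hw
      rw [mem_singleton_iff.1 hw]
      have := dist_triangle_right (p a m) (p b m) z
      linarith [h1 b hab]
  · obtain ⟨δ, hδ, hfar⟩ := exists_pos_le_dist_of_not_tendsto U hconv
    set ρ := min (r / 2) (δ / 4) with hρdef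
    have hρ : 0 < ρ := by positivity
    have hρr : 2 * ρ ≤ r := by linarith [min_le_left (r / 2) (δ / 4)]
    have hρδ : 2 * ρ ≤ δ / 2 := by linarith [min_le_right (r / 2) (δ / 4)]
    let G : ℕ → Prop := fun m => (∀ b, R a b → dist (p b m) (p a m) < ρ) ∧
      ∀ b, ¬R a b → r ≤ dist (p a m) (p b m)
    -- Separation between two times: the class representative at either time is far from all the
    -- points at the other time.
    let Q : ℕ → ℕ → Prop := fun n m => ∀ b, δ / 2 ≤ dist (p a m) (p b n) ∧
      δ / 2 ≤ dist (p b m) (p a n)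
    have hG : ∀ᶠ m in U, G m := (hclose ρ hρ).and hr
    have hQ : ∀ᶠ n in U, ∀ᶠ m in U, Q n m := by
      have hQb : ∀ b, ∀ᶠ n in U, ∀ᶠ m in U, δ / 2 ≤ dist (p b m) (p a n) := by
        -- Otherwise `p b m` would, for `U`-many `m`, be within `δ/2` of both `p a n₀` and `p a n`,
        -- for two times with `dist (p a n) (p a n₀) ≥ δ`.
        intro b
        by_contra hc
        have hc := Ultrafilter.eventually_not.2 hc
        obtain ⟨n₀, hn₀⟩ := hc.exists
        obtain ⟨n, hn, hn'⟩ := (hc.and (hfar (p a n₀))).exists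
        obtain ⟨m, hm, hm'⟩ :=
          ((Ultrafilter.eventually_not.2 hn₀).and (Ultrafilter.eventually_not.2 hn)).exists
        have := dist_triangle_left (p a n) (p a n₀) (p b m)
        linarith
      filter_upwards [eventually_all.2 hQb] with n hn
      filter_upwards [eventually_all.2 hn, eventually_all.2 fun b => hfar (p b n)] with m h1 h2 b
      exact ⟨by linarith [h2 b], h1 b⟩
    -- Greedy choice of times: each new time is good and separated from the finitely many earlier
    -- ones, so the bumps around the points `p a (φ j)` do not interfere across times.
    obtain ⟨φ, hφ1, hφ2⟩ := exists_seq_of_forall_finset_exists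
      (fun n => G n ∧ ∀ᶠ m in U, Q n m) (fun n m => n < m ∧ Q n m) (by
        intro s hs
        have h1 : ∀ᶠ m in U, ∀ n ∈ s, n < m ∧ Q n m := by
          refine (eventually_all_finset s).2 fun n hn => ?_
          exact ((eventually_gt_atTop n).filter_mono hU1).and (hs n hn).2
        obtain ⟨m, hm⟩ := ((hG.and hQ).and h1).exists
        exact ⟨m, hm⟩)
    have hmono : StrictMono φ := fun i j hij => (hφ2 i j hij).1
    refine ⟨range fun j => p a (φ j), ρ, hρ, range_nonempty _, ?_⟩
    refine hmono.tendsto_atTop.frequently (Eventually.frequently (Eventually.of_forall fun j => ?_))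
    intro b
    refine ⟨fun hab => ⟨_, mem_range_self j, ((hφ1 j).1.1 b hab).le⟩, ?_⟩
    rintro hab _ ⟨i, rfl⟩
    rcases lt_trichotomy i j with hij | rfl | hij
    · linarith [((hφ2 i j hij).2 b).2]
    · have := (hφ1 i).1.2 b hab
      rw [dist_comm] at this
      linarith
    · have := ((hφ2 j i hij).2 b).1
      rw [dist_comm] at this
      linarith

end Matching

/-! ### Calculus of `∫ f dπ` for Lipschitz functions on the line -/

section RealLine

variable {g h : ℝ → ℝ} {K L : ℝ≥0}

theorem abs_deriv_le (hg : LipschitzWith K g) (t : ℝ) : |deriv g t| ≤ K :=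
  norm_deriv_le_of_lipschitz hg

theorem absolutelyContinuousOnInterval_of_lipschitz (hg : LipschitzWith K g) (a b : ℝ) :
    AbsolutelyContinuousOnInterval g a b :=
  (hg.lipschitzOnWith (s := uIcc a b)).absolutelyContinuousOnInterval

theorem intervalIntegrable_mul_deriv (hh : Continuous h) (hg : LipschitzWith K g) (a b : ℝ) :
    IntervalIntegrable (fun t => h t * deriv g t) volume a b :=
  (absolutelyContinuousOnInterval_of_lipschitz hg a b).intervalIntegrable_deriv.continuousOn_mul
    hh.continuousOn

theorem integral_deriv_eq_sub_of_lipschitz (hg : LipschitzWith K g) (a b : ℝ) :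
    ∫ t in a..b, deriv g t = g b - g a :=
  (absolutelyContinuousOnInterval_of_lipschitz hg a b).integral_deriv_eq_sub

/-- Integrals `∫ h dg` are continuous under pointwise convergence of uniformly Lipschitz `g`. -/
theorem tendsto_integral_mul_deriv {gs : ℕ → ℝ → ℝ} (hh : LipschitzWith L h)
    (hgs : ∀ j, LipschitzWith K (gs j)) (hg : LipschitzWith K g)
    (hlim : ∀ t, Tendsto (fun j => gs j t) atTop (𝓝 (g t))) {a b : ℝ} :
    Tendsto (fun j => ∫ t in a..b, h t * deriv (gs j) t) atTop
      (𝓝 (∫ t in a..b, h t * deriv g t)) := by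
  -- Integration by parts moves the derivative off the varying function, whose derivatives need not
  -- converge; dominated convergence then applies to the functions themselves.
  have hparts : ∀ {u : ℝ → ℝ}, LipschitzWith K u → ∫ t in a..b, h t * deriv u t =
      h b * u b - h a * u a - ∫ t in a..b, deriv h t * u t := fun hu =>
    (absolutelyContinuousOnInterval_of_lipschitz hh a b).integral_mul_deriv_eq_deriv_mul
      (absolutelyContinuousOnInterval_of_lipschitz hu a b)
  simp only [hparts (hgs _), hparts hg]
  refine (((hlim b).const_mul _).sub ((hlim a).const_mul _)).sub ?_
  obtain ⟨M, hM⟩ := (hlim a).abs.bddAbove_range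
  have hM : ∀ j, |gs j a| ≤ M := fun j => hM (mem_range_self j)
  refine intervalIntegral.tendsto_integral_filter_of_dominated_convergence
    (fun t => (L : ℝ) * (M + K * |t - a|)) (Eventually.of_forall fun j => ?_)
    (Eventually.of_forall fun j => Eventually.of_forall fun t _ => ?_) ?_
    (Eventually.of_forall fun t _ => (hlim t).const_mul _)
  · exact ((measurable_deriv h).mul (hgs j).continuous.measurable).aestronglyMeasurable
  · rw [norm_mul]
    refine mul_le_mul (abs_deriv_le hh t) ?_ (norm_nonneg _) L.2
    have h1 := (hgs j).dist_le_mul t a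
    rw [Real.dist_eq, Real.dist_eq] at h1
    have h2 := abs_sub_abs_le_abs_sub (gs j t) (gs j a)
    rw [Real.norm_eq_abs]
    linarith [hM j]
  · exact (by fun_prop : Continuous fun t => (L : ℝ) * (M + K * |t - a|)).intervalIntegrable _ _

/-- The error of the one-step Riemann sum of `∫ u dg` is quadratic. -/
theorem abs_integral_mul_deriv_sub_le {u : ℝ → ℝ} (hu : LipschitzWith L u)
    (hg : LipschitzWith K g) (s t : ℝ) :
    |(∫ τ in s..t, u τ * deriv g τ) - u s * (g t - g s)| ≤ L * K * |t - s| ^ 2 := by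
  have hi := intervalIntegrable_mul_deriv hu.continuous hg s t
  have hi2 := (absolutelyContinuousOnInterval_of_lipschitz hg s t).intervalIntegrable_deriv.const_mul
    (u s)
  rw [← integral_deriv_eq_sub_of_lipschitz hg, ← intervalIntegral.integral_const_mul,
    ← intervalIntegral.integral_sub hi hi2]
  have hb : ∀ τ ∈ uIoc s t, ‖u τ * deriv g τ - u s * deriv g τ‖ ≤ L * |t - s| * K := by
    intro τ hτ
    rw [← sub_mul, norm_mul]
    refine mul_le_mul ?_ (abs_deriv_le hg τ) (norm_nonneg _) (by positivity)
    have h1 := hu.dist_le_mul τ s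
    rw [Real.dist_eq, Real.dist_eq] at h1
    refine h1.trans (mul_le_mul_of_nonneg_left ?_ L.2)
    exact abs_sub_left_of_mem_uIcc (uIoc_subset_uIcc hτ)
  refine (intervalIntegral.norm_integral_le_of_norm_le_const hb).trans_eq ?_
  ring

/-- A quadratic modulus makes the derivative vanish everywhere. -/
theorem eq_of_abs_sub_le_sq {G : ℝ → ℝ} {C : ℝ} (hG : ∀ s t, |G t - G s| ≤ C * |t - s| ^ 2)
    (s t : ℝ) : G t = G s := by
  have hd : ∀ s, HasDerivAt G 0 s := by
    intro s
    rw [hasDerivAt_iff_isLittleO]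
    have h1 : (fun t => G t - G s - (t - s) • (0 : ℝ)) =O[𝓝 s] fun t => (t - s) ^ 2 := by
      refine Asymptotics.IsBigO.of_bound C (Eventually.of_forall fun t => ?_)
      simpa using hG s t
    refine h1.trans_isLittleO ?_
    have h2 : (fun x : ℝ => x ^ 2) =o[𝓝 0] fun x => x := by
      simpa using Asymptotics.isLittleO_pow_pow (𝕜 := ℝ) (m := 1) (n := 2) one_lt_two
    have h3 : Tendsto (fun t => t - s) (𝓝 s) (𝓝 0) := by
      have : Continuous fun t : ℝ => t - s := by fun_prop
      simpa using this.tendsto s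
    exact h2.comp_tendsto h3
  exact is_const_of_deriv_eq_zero (fun s => (hd s).differentiableAt) (fun s => (hd s).deriv) t s

/-- Change of variables for `∫ f dπ` along a Lipschitz function, which need not be monotone. -/
theorem integral_comp_mul_deriv_comp {f π : ℝ → ℝ} {A B : ℝ≥0} (hf : LipschitzWith A f)
    (hπ : LipschitzWith B π) (hh : LipschitzWith K h) (a b : ℝ) :
    ∫ t in a..b, f (h t) * deriv (π ∘ h) t = ∫ x in h a..h b, f x * deriv π x := by
  have hi := fun s t => intervalIntegrable_mul_deriv (hf.comp hh).continuous (hπ.comp hh) s t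
  have hi2 := fun s t => intervalIntegrable_mul_deriv hf.continuous hπ s t
  -- As functions of the upper limit, both sides have increment `f (h s) * (π (h t) - π (h s))` up
  -- to a quadratic error. This avoids the chain rule, which may fail where `π` is not
  -- differentiable at `h t`.
  have key : ∀ s t,
      |((∫ τ in a..t, f (h τ) * deriv (π ∘ h) τ) - ∫ x in h a..h t, f x * deriv π x) -
        ((∫ τ in a..s, f (h τ) * deriv (π ∘ h) τ) - ∫ x in h a..h s, f x * deriv π x)| ≤
      (2 * (A * K * (B * K))) * |t - s| ^ 2 := by
    intro s t
    have e1 : (∫ τ in a..t, f (h τ) * deriv (π ∘ h) τ) - ∫ τ in a..s, f (h τ) * deriv (π ∘ h) τ =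
      ∫ τ in s..t, f (h τ) * deriv (π ∘ h) τ :=
      intervalIntegral.integral_interval_sub_left (hi a t) (hi a s)
    have e2 : (∫ x in h a..h t, f x * deriv π x) - ∫ x in h a..h s, f x * deriv π x =
      ∫ x in h s..h t, f x * deriv π x :=
      intervalIntegral.integral_interval_sub_left (hi2 _ _) (hi2 _ _)
    have b1 := abs_integral_mul_deriv_sub_le (hf.comp hh) (hπ.comp hh) s t
    have b2 := abs_integral_mul_deriv_sub_le hf hπ (h s) (h t)
    have b3 : |h t - h s| ≤ K * |t - s| := by
      simpa only [Real.dist_eq] using hh.dist_le_mul t s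
    have b4 : (A * B : ℝ) * |h t - h s| ^ 2 ≤ A * B * (K * |t - s|) ^ 2 := by gcongr
    simp only [Function.comp_apply] at b1
    push_cast at b1
    rw [abs_le] at b1 b2 ⊢
    simp only [Function.comp_def] at *
    constructor <;> nlinarith
  have := eq_of_abs_sub_le_sq key a b
  simp only [intervalIntegral.integral_same, sub_zero] at this
  exact sub_eq_zero.1 this

/-- A bounded open set of reals is, up to a null set, a disjoint union of countably many
intervals. -/
theorem exists_disjoint_intervals {W : Set ℝ} (hW : IsOpen W) {c d : ℝ} (hcd : W ⊆ Icc c d) :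
    ∃ (ι : Type) (_ : Countable ι) (I : ι → Set ℝ) (a b : ι → ℝ),
      (∀ i, MeasurableSet (I i)) ∧ Pairwise (Function.onFun Disjoint I) ∧ W = ⋃ i, I i ∧
      ∀ i, a i ≤ b i ∧ I i =ᵐ[volume] Ioc (a i) (b i) := by
  set 𝒞 : Set (Set ℝ) := {C | ∃ x ∈ W, C = connectedComponentIn W x}
  have ho : ∀ C ∈ 𝒞, IsOpen C := by
    rintro _ ⟨x, -, rfl⟩
    exact hW.connectedComponentIn
  have hc : ∀ C ∈ 𝒞, IsConnected C := by
    rintro _ ⟨x, hx, rfl⟩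
    exact isConnected_connectedComponentIn_iff.2 hx
  have hd : 𝒞.PairwiseDisjoint id := by
    rintro _ ⟨x, hx, rfl⟩ _ ⟨y, hy, rfl⟩ hne
    refine Set.disjoint_left.2 fun z hz hz' => hne ?_
    rw [connectedComponentIn_eq hz, connectedComponentIn_eq hz']
  have hcount : 𝒞.Countable := hd.countable_of_isOpen ho fun C hC => (hc C hC).nonempty
  refine ⟨𝒞, hcount.to_subtype, fun C => C, fun C => sInf (C : Set ℝ), fun C => sSup (C : Set ℝ),
    fun C => (ho C C.2).measurableSet, fun C D hne => hd C.2 D.2 (Subtype.coe_ne_coe.2 hne), ?_, ?_⟩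
  · refine Subset.antisymm (fun x hx => ?_) (iUnion_subset ?_)
    · exact mem_iUnion.2 ⟨⟨_, x, hx, rfl⟩, mem_connectedComponentIn hx⟩
    · rintro ⟨_, x, hx, rfl⟩
      exact connectedComponentIn_subset W x
  · rintro ⟨C, hC⟩
    have hCW : C ⊆ Icc c d := by
      obtain ⟨x, -, rfl⟩ := hC
      exact (connectedComponentIn_subset W x).trans hcd
    have hb : BddBelow C := bddBelow_Icc.mono hCW
    have ha : BddAbove C := bddAbove_Icc.mono hCW
    refine ⟨csInf_le_csSup (hc C hC).nonempty hb ha, ?_⟩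
    refine EventuallyLE.antisymm ?_ ?_
    · refine EventuallyLE.trans (g := Icc (sInf C) (sSup C)) ?_ Ioc_ae_eq_Icc.symm.le
      exact (subset_Icc_csInf_csSup hb ha).eventuallyLE
    · refine EventuallyLE.trans (g := Ioo (sInf C) (sSup C)) Ioo_ae_eq_Ioc.symm.le ?_
      exact ((hc C hC).Ioo_csInf_csSup_subset hb ha).eventuallyLE

/-- The indicator function of the oriented interval from `p` to `q`. -/
noncomputable def orientedIndicator (p q x : ℝ) : ℤ :=
  (Ioc p q).indicator 1 x - (Ioc q p).indicator 1 x

theorem measurable_orientedIndicator (p q : ℝ) :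
    Measurable fun x => (orientedIndicator p q x : ℝ) := by
  have : Measurable (orientedIndicator p q) :=
    (measurable_one.indicator measurableSet_Ioc).sub (measurable_one.indicator measurableSet_Ioc)
  exact (measurable_of_countable (fun n : ℤ => (n : ℝ))).comp this

theorem abs_orientedIndicator (p q x : ℝ) :
    |(orientedIndicator p q x : ℝ)| = (uIoc p q).indicator 1 x := by
  rcases le_total p q with hpq | hpq
  · by_cases hx : x ∈ Ioc p q <;> simp [orientedIndicator, hpq, hx]
  · by_cases hx : x ∈ Ioc q p <;> simp [orientedIndicator, hpq, hx]

theorem integrable_orientedIndicator_mul (p q : ℝ) {u : ℝ → ℝ}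
    (hu : IntervalIntegrable u volume p q) :
    Integrable fun x => (orientedIndicator p q x : ℝ) * u x := by
  have h1 : Integrable ((uIoc p q).indicator u) :=
    (integrable_indicator_iff measurableSet_uIoc).2 hu.def'
  have h2 := h1.bdd_mul (c := 1) (measurable_orientedIndicator p q).aestronglyMeasurable
    (Eventually.of_forall fun x => by
      rw [Real.norm_eq_abs, abs_orientedIndicator]
      exact indicator_le_self' (by simp) x)
  refine h2.congr (Eventually.of_forall fun x => ?_)
  by_cases hx : x ∈ uIoc p q
  · simp [hx]
  · have : (orientedIndicator p q x : ℝ) = 0 := by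
      rw [← abs_eq_zero, abs_orientedIndicator, indicator_of_notMem hx]
    simp [this]

theorem integral_orientedIndicator_mul (p q : ℝ) (u : ℝ → ℝ) :
    ∫ x, (orientedIndicator p q x : ℝ) * u x = ∫ x in p..q, u x := by
  rcases le_total p q with hpq | hpq
  · rw [intervalIntegral.integral_of_le hpq, ← integral_indicator measurableSet_Ioc]
    refine integral_congr_ae (Eventually.of_forall fun x => ?_)
    by_cases hx : x ∈ Ioc p q <;> simp [orientedIndicator, hpq, hx]
  · rw [intervalIntegral.integral_of_ge hpq, ← integral_indicator measurableSet_Ioc, ← integral_neg]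
    refine integral_congr_ae (Eventually.of_forall fun x => ?_)
    by_cases hx : x ∈ Ioc q p <;> simp [orientedIndicator, hpq, hx]

end RealLine

/-! ### Integer multiplicity of push-forwards of open sets of reals -/

section RealLine

variable {h : ℝ → ℝ} {K : ℝ≥0}

/-- The push-forward of a bounded open set of reals under a Lipschitz function has an integrable,
integer valued multiplicity. -/
theorem exists_multiplicity (hh : LipschitzWith K h) {W : Set ℝ} (hW : IsOpen W) {c d : ℝ}
    (hcd : W ⊆ Icc c d) :
    ∃ θ : ℝ → ℤ, Integrable (fun x => (θ x : ℝ)) ∧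
      ∀ (f π : ℝ → ℝ) (A B : ℝ≥0) (M : ℝ), LipschitzWith A f → LipschitzWith B π →
        (∀ x, |f x| ≤ M) →
        ∫ t in W, f (h t) * deriv (π ∘ h) t = ∫ x, (θ x : ℝ) * (f x * deriv π x) := by
  obtain ⟨ι, _, I, a, b, hIm, hId, hWI, hI⟩ := exists_disjoint_intervals hW hcd
  have hvol : ∀ i, volume (I i) = ENNReal.ofReal (b i - a i) := fun i => by
    rw [measure_congr (hI i).2, Real.volume_Ioc]
  have hWfin : volume W ≠ ∞ := ((measure_mono hcd).trans_lt measure_Icc_lt_top).ne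
  have hsum : Summable fun i => b i - a i := by
    have h1 : ∑' i, volume (I i) ≠ ∞ := by
      rwa [← measure_iUnion hId hIm, ← hWI]
    have h2 := ENNReal.summable_toReal h1
    refine h2.congr fun i => ?_
    rw [hvol, ENNReal.toReal_ofReal (sub_nonneg.2 (hI i).1)]
  -- Each component pushes forward to the oriented interval between the images of its end points.
  -- The `L¹` norms are at most `K` times the lengths of the components, hence summable.
  set o : ι → ℝ → ℤ := fun i => orientedIndicator (h (a i)) (h (b i))
  have hoi : ∀ i, Integrable fun x => (o i x : ℝ) := fun i => by
    simpa using integrable_orientedIndicator_mul (h (a i)) (h (b i))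
      (intervalIntegrable_const (c := (1 : ℝ)))
  have hlen : ∀ i, |h (b i) - h (a i)| ≤ K * (b i - a i) := fun i => by
    have := hh.dist_le_mul (b i) (a i)
    rwa [Real.dist_eq, Real.dist_eq, abs_of_nonneg (sub_nonneg.2 (hI i).1)] at this
  have honorm : ∀ i, ∫ x, ‖(o i x : ℝ)‖ = |h (b i) - h (a i)| := fun i => by
    simp only [Real.norm_eq_abs, o, abs_orientedIndicator]
    rw [integral_indicator measurableSet_uIoc]
    simp [Measure.real, uIoc, Real.volume_Ioc, max_sub_min_eq_abs']
    rw [abs_sub_comm]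
  have honsum : Summable fun i => ∫ x, ‖(o i x : ℝ)‖ := by
    refine Summable.of_nonneg_of_le (fun i => integral_nonneg fun _ => norm_nonneg _) (fun i => ?_)
      (hsum.mul_left (K : ℝ))
    rw [honorm]
    exact hlen i
  have hlint : ∑' i, ∫⁻ x, ‖(o i x : ℝ)‖ₑ ≠ ∞ := by
    have : ∀ i, ∫⁻ x, ‖(o i x : ℝ)‖ₑ = ENNReal.ofReal (∫ x, ‖(o i x : ℝ)‖) := fun i =>
      (ofReal_integral_norm_eq_lintegral_enorm (hoi i)).symm
    simp only [this]
    rw [← ENNReal.ofReal_tsum_of_nonneg (fun i => integral_nonneg fun _ => norm_nonneg _) honsum]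
    exact ENNReal.ofReal_ne_top
  have hae : ∀ᵐ x, Summable fun i => ‖(o i x : ℝ)‖ :=
    summable_norm_of_tsum_eLpNorm_ne_top le_rfl (fun i => (hoi i).1)
      (by simpa only [eLpNorm_one_eq_lintegral_enorm] using hlint)
  -- Absolutely summable integers are almost all 0, so at almost every point the sum is finite and
  -- may be taken in `ℤ`.
  have hcast : ∀ᵐ x, ((∑' i, o i x : ℤ) : ℝ) = ∑' i, (o i x : ℝ) := by
    filter_upwards [hae] with x hx
    have hfin : (Function.support fun i => o i x).Finite := by
      have h2 : ∀ᶠ i in cofinite, ‖(o i x : ℝ)‖ < 1 :=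
        hx.tendsto_cofinite_zero.eventually (gt_mem_nhds one_pos)
      refine Set.Finite.subset h2 fun i hi (hlt : |(o i x : ℝ)| < 1) => hi ?_
      have : |o i x| < 1 := by exact_mod_cast hlt
      exact Int.abs_lt_one_iff.1 this
    have hs : Summable fun i => o i x := summable_of_hasFiniteSupport hfin
    exact ((hs.hasSum.map (Int.castAddHom ℝ) continuous_of_discreteTopology).tsum_eq).symm
  have hTm : Measurable fun x => ∑' i, (o i x : ℝ) :=
    Measurable.tsum fun i => measurable_orientedIndicator _ _
  refine ⟨fun x => ∑' i, o i x, ?_, ?_⟩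
  · refine Integrable.congr (f := fun x => ∑' i, (o i x : ℝ)) ⟨hTm.aestronglyMeasurable, ?_⟩
      (hcast.mono fun x hx => hx.symm)
    refine lt_of_le_of_lt (lintegral_mono fun x => enorm_tsum_le_tsum_enorm) ?_
    rw [lintegral_tsum fun i => (hoi i).1.enorm]
    exact hlint.lt_top
  · intro f π A B M hf hπ hM
    have hM0 : 0 ≤ M := (abs_nonneg _).trans (hM 0)
    have hu : ∀ x, ‖f x * deriv π x‖ ≤ M * B := fun x => by
      rw [norm_mul]
      exact mul_le_mul (hM x) (abs_deriv_le hπ x) (norm_nonneg _) hM0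
    have hui : ∀ p q, IntervalIntegrable (fun x => f x * deriv π x) volume p q :=
      intervalIntegrable_mul_deriv hf.continuous hπ
    have hFi : ∀ i, Integrable fun x => (o i x : ℝ) * (f x * deriv π x) := fun i =>
      integrable_orientedIndicator_mul _ _ (hui _ _)
    have hFsum : Summable fun i => ∫ x, ‖(o i x : ℝ) * (f x * deriv π x)‖ := by
      refine Summable.of_nonneg_of_le (fun i => integral_nonneg fun _ => norm_nonneg _)
        (fun i => ?_) (honsum.mul_right (M * B))
      rw [← integral_mul_const]
      refine integral_mono (hFi i).norm ((hoi i).norm.mul_const _) fun x => ?_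
      change ‖(o i x : ℝ) * (f x * deriv π x)‖ ≤ ‖(o i x : ℝ)‖ * (M * B)
      rw [norm_mul]
      exact mul_le_mul_of_nonneg_left (hu x) (norm_nonneg _)
    have h1 := hasSum_integral_of_summable_integral_norm hFi hFsum
    have h2 : ∫ x, ∑' i, (o i x : ℝ) * (f x * deriv π x) =
        ∫ x, ((∑' i, o i x : ℤ) : ℝ) * (f x * deriv π x) := by
      refine integral_congr_ae ?_
      filter_upwards [hcast] with x hx
      rw [hx, tsum_mul_right]
    rw [h2] at h1
    have h3 : ∀ i, ∫ x, (o i x : ℝ) * (f x * deriv π x) =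
        ∫ t in I i, f (h t) * deriv (π ∘ h) t := fun i => by
      rw [integral_orientedIndicator_mul, ← integral_comp_mul_deriv_comp hf hπ hh,
        intervalIntegral.integral_of_le (hI i).1, setIntegral_congr_set (hI i).2]
    simp only [h3] at h1
    have hint : IntegrableOn (fun t => f (h t) * deriv (π ∘ h) t) (⋃ i, I i) := by
      rw [← hWI]
      have h4 := intervalIntegrable_mul_deriv (hf.comp hh).continuous (hπ.comp hh) c d
      rcases le_total c d with hle | hle
      · exact ((intervalIntegrable_iff_integrableOn_Icc_of_le hle).1 h4).mono_set hcd
      · have : volume W = 0 := by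
          refine measure_mono_null hcd ?_
          rw [Real.volume_Icc, ENNReal.ofReal_eq_zero]
          linarith
        rw [IntegrableOn, Measure.restrict_eq_zero.2 this]
        exact integrable_zero_measure
    have h5 := hasSum_integral_iUnion hIm hId hint
    rw [← hWI] at h5
    exact h5.unique h1

end RealLine

/-! ### Speed of Lipschitz curves and `ℋ¹`-null sets -/

section Curves

variable {γ : ℝ → X} {K : ℝ≥0}

/-- A curve, composed with any Lipschitz function, has vanishing derivative almost everywhere on
the preimage of an `ℋ¹`-null set. -/
theorem ae_deriv_comp_eq_zero [MeasurableSpace X] [BorelSpace X] (γ : ℝ → X) {N : Set X}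
    (hN : Measure.hausdorffMeasure 1 N = 0) :
    ∀ᵐ t, γ t ∈ N → ∀ (π : X → ℝ) (L : ℝ≥0), LipschitzWith L π → deriv (π ∘ γ) t = 0 := by
  -- On these pieces `γ` shrinks distances at most by the factor `1/(n+1)`: the floor condition
  -- keeps two points of a piece close enough for the local estimate. So `γ` has there a Lipschitz
  -- inverse, and the piece is null because its image lies in `N`.
  set E : ℕ → ℤ → Set ℝ := fun n j => {t | γ t ∈ N ∧ ⌊t * (n + 1)⌋ = j ∧
    ∀ s, |s - t| * (n + 1) < 1 → |s - t| ≤ (n + 1) * dist (γ s) (γ t)}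
  have hE : ∀ n j, volume (E n j) = 0 := by
    intro n j
    have hn : (0 : ℝ) < n + 1 := by positivity
    have hdist : ∀ t ∈ E n j, ∀ s ∈ E n j, dist s t ≤ (n + 1) * dist (γ s) (γ t) := by
      intro t ht s hs
      refine ht.2.2 s ?_
      have := Int.abs_sub_lt_one_of_floor_eq_floor (hs.2.1.trans ht.2.1.symm)
      rwa [← sub_mul, abs_mul, abs_of_pos hn] at this
    have hinj : InjOn γ (E n j) := fun s hs t ht hst => by
      have := hdist t ht s hs
      rw [hst, dist_self, mul_zero] at this
      exact dist_le_zero.1 this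
    have hl : LipschitzOnWith (n + 1) (Function.invFunOn γ (E n j)) (γ '' E n j) := by
      refine LipschitzOnWith.of_dist_le_mul ?_
      rintro _ ⟨s, hs, rfl⟩ _ ⟨t, ht, rfl⟩
      rw [hinj.leftInvOn_invFunOn hs, hinj.leftInvOn_invFunOn ht]
      simpa using hdist t ht s hs
    have h1 := hl.hausdorffMeasure_image_le (d := 1) zero_le_one
    rw [hinj.leftInvOn_invFunOn.image_image, hausdorffMeasure_real] at h1
    have h2 : Measure.hausdorffMeasure 1 (γ '' E n j) = 0 :=
      measure_mono_null (image_subset_iff.2 fun t ht => ht.1) hN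
    rw [h2, mul_zero] at h1
    exact le_antisymm h1 zero_le
  have hE' : ∀ᵐ t, ∀ n j, t ∉ E n j :=
    ae_all_iff.2 fun n => ae_all_iff.2 fun j => measure_eq_zero_iff_ae_notMem.1 (hE n j)
  filter_upwards [hE'] with t ht htN π L hπ
  by_contra hne
  have hd : DifferentiableAt ℝ (π ∘ γ) t := by
    by_contra h
    exact hne (deriv_zero_of_not_differentiableAt h)
  set D := deriv (π ∘ γ) t
  have hD : 0 < |D| := abs_pos.2 hne
  have hlo := (hasDerivAt_iff_isLittleO.1 hd.hasDerivAt).def (half_pos hD)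
  obtain ⟨δ, hδ, hball⟩ := Metric.eventually_nhds_iff.1 hlo
  -- The first bound puts the contracted point `s` into the `δ`-ball where the derivative estimate
  -- holds; the second makes the contraction too strong for slope `D`.
  obtain ⟨n, hn⟩ := exists_nat_gt (max (1 / δ) (2 * L / |D|))
  have hn0 : (0 : ℝ) < n + 1 := by positivity
  have hn1 : 1 < δ * (n + 1) := by
    have := (le_max_left _ _).trans_lt hn
    rw [div_lt_iff₀ hδ] at this
    linarith
  have hn2 : 2 * L < |D| * (n + 1) := by
    have := (le_max_right _ _).trans_lt hn
    rw [div_lt_iff₀ hD] at this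
    linarith
  have hnot := ht n ⌊t * (n + 1)⌋
  have : ∃ s, |s - t| * (n + 1) < 1 ∧ (n + 1) * dist (γ s) (γ t) < |s - t| := by
    by_contra! hall
    exact hnot ⟨htN, rfl, hall⟩
  obtain ⟨s, hs1, hs2⟩ := this
  have hst : |s - t| < δ := by
    by_contra! hge
    have := mul_le_mul_of_nonneg_right hge hn0.le
    linarith
  have h1 := hball (y := s) (by rwa [Real.dist_eq])
  have h2 : |π (γ s) - π (γ t)| ≤ L * dist (γ s) (γ t) := by
    simpa only [Real.dist_eq] using hπ.dist_le_mul (γ s) (γ t)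
  simp only [Function.comp_apply, smul_eq_mul, Real.norm_eq_abs] at h1
  change |π (γ s) - π (γ t) - (s - t) * D| ≤ _ at h1
  have h3 : |(s - t) * D| ≤ |D| / 2 * |s - t| + L * dist (γ s) (γ t) := by
    have := abs_sub_abs_le_abs_sub ((s - t) * D) (π (γ s) - π (γ t))
    rw [abs_sub_comm ((s - t) * D)] at this
    linarith
  rw [abs_mul] at h3
  have hpos : 0 < |s - t| := lt_of_le_of_lt (by positivity) hs2
  have h4 : |s - t| * |D| * (n + 1) ≤ 2 * (L * ((n + 1) * dist (γ s) (γ t))) := by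
    have := mul_le_mul_of_nonneg_right (by linarith : |s - t| * |D| ≤ 2 * (L * dist (γ s) (γ t))) hn0.le
    linarith
  have h5 : 2 * (L * ((n + 1) * dist (γ s) (γ t))) ≤ 2 * (L * |s - t|) := by
    have := mul_le_mul_of_nonneg_left hs2.le L.coe_nonneg
    linarith
  have h6 := mul_lt_mul_of_pos_left hn2 hpos
  nlinarith

/-- The speed of a Lipschitz curve: it bounds the derivatives of the curve composed with Lipschitz
functions, and its integral is at most the length. -/
theorem exists_speed (hγ : LipschitzWith K γ) :
    ∃ s : ℝ → ℝ≥0∞, Measurable s ∧ ∫⁻ t in Ioc 0 1, s t ≤ eVariationOn γ (Icc 0 1) ∧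
      ∀ (π : X → ℝ) (L : ℝ≥0), LipschitzWith L π →
        ∀ᵐ t, ‖deriv (π ∘ γ) t‖ₑ ≤ L * s t := by
  have hbv : LocallyBoundedVariationOn γ univ := hγ.locallyBoundedVariationOn univ
  -- The speed is the derivative of the arc length `v`. Since `v` is monotone, its derivative
  -- integrates to at most its increment, and `dist (γ s) (γ t) ≤ v s - v t` compares the slopes.
  set v : ℝ → ℝ := variationOnFromTo γ univ 0
  have hv : Monotone v := fun a b hab =>
    variationOnFromTo.monotoneOn hbv (mem_univ 0) (mem_univ a) (mem_univ b) hab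
  refine ⟨fun t => ENNReal.ofReal (deriv v t), (measurable_deriv v).ennreal_ofReal, ?_, ?_⟩
  · have hi := (hv.monotoneOn (uIcc 0 1)).intervalIntegrable_deriv
    have h1 := (hv.monotoneOn (uIcc 0 1)).intervalIntegral_deriv_mem_uIcc
    rw [uIcc_of_le (sub_nonneg.2 (hv zero_le_one)), intervalIntegral.integral_of_le zero_le_one] at h1
    rw [← ofReal_integral_eq_lintegral_ofReal
      ((intervalIntegrable_iff_integrableOn_Ioc_of_le zero_le_one).1 hi)
      (Eventually.of_forall fun t => hv.deriv_nonneg)]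
    refine (ENNReal.ofReal_le_ofReal h1.2).trans ?_
    simp only [v, variationOnFromTo.self, sub_zero, variationOnFromTo.eq_of_le _ _ zero_le_one,
      univ_inter]
    exact ENNReal.ofReal_toReal_le
  · intro π L hπ
    filter_upwards [hv.ae_differentiableAt] with t ht
    have hd0 : 0 ≤ deriv v t := hv.deriv_nonneg
    by_cases hd : DifferentiableAt ℝ (π ∘ γ) t
    · have hle : |deriv (π ∘ γ) t| ≤ L * deriv v t := by
        have t1 := (hd.hasDerivAt.tendsto_slope.mono_left
          (nhdsWithin_mono t fun s (hs : s ∈ Ioi t) => (ne_of_gt hs))).abs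
        have t2 := (ht.hasDerivAt.tendsto_slope.mono_left
          (nhdsWithin_mono t fun s (hs : s ∈ Ioi t) => (ne_of_gt hs))).const_mul (L : ℝ)
        refine le_of_tendsto_of_tendsto t1 t2 ?_
        filter_upwards [self_mem_nhdsWithin] with s hs
        have hs : 0 < s - t := sub_pos.2 hs
        rw [slope_def_field, slope_def_field, abs_div, abs_of_pos hs, mul_div_assoc']
        refine div_le_div_of_nonneg_right ?_ hs.le
        have h2 : |π (γ s) - π (γ t)| ≤ L * dist (γ s) (γ t) := by
          simpa only [Real.dist_eq] using hπ.dist_le_mul (γ s) (γ t)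
        have h3 : dist (γ s) (γ t) ≤ v s - v t := by
          have hts : t ≤ s := by linarith
          rw [variationOnFromTo.sub_right hbv (mem_univ 0) (mem_univ s) (mem_univ t),
            variationOnFromTo.eq_of_le _ _ hts, dist_edist]
          refine ENNReal.toReal_mono (hbv t s (mem_univ t) (mem_univ s)) ?_
          exact eVariationOn.edist_le γ ⟨mem_univ s, hts, le_rfl⟩ ⟨mem_univ t, le_rfl, hts⟩
        exact h2.trans (mul_le_mul_of_nonneg_left h3 L.coe_nonneg)
      rw [Real.enorm_eq_ofReal_abs, ← ENNReal.ofReal_coe_nnreal, ← ENNReal.ofReal_mul L.coe_nonneg]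
      exact ENNReal.ofReal_le_ofReal hle
    · rw [deriv_zero_of_not_differentiableAt hd]
      simp

end Curves

/-! ### Integration along one curve -/

section CurveIntegral

/-- The integral of `u dπ` along the curve `γ` on `[0, 1]`. -/
noncomputable def lineIntegral {X : Type*} (γ : ℝ → X) (u π : X → ℝ) : ℝ :=
  ∫ t in Ioc (0 : ℝ) 1, u (γ t) * deriv (π ∘ γ) t

theorem lineIntegral_eq_intervalIntegral {X : Type*} (γ : ℝ → X) (u π : X → ℝ) :
    lineIntegral γ u π = ∫ t in (0 : ℝ)..1, u (γ t) * deriv (π ∘ γ) t :=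
  (intervalIntegral.integral_of_le zero_le_one).symm

variable {γ : ℝ → X} {K L : ℝ≥0} {π : X → ℝ}

theorem integrableOn_lineIntegral [MeasurableSpace X] [BorelSpace X] (hγ : LipschitzWith K γ)
    (hπ : LipschitzWith L π) {u : X → ℝ} (hu : Measurable u) {M : ℝ} (hM : ∀ x, |u x| ≤ M) :
    IntegrableOn (fun t => u (γ t) * deriv (π ∘ γ) t) (Ioc 0 1) := by
  refine Measure.integrableOn_of_bounded (M := M * (L * K : ℝ≥0)) measure_Ioc_lt_top.ne ?_
    (Eventually.of_forall fun t => ?_)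
  · exact ((hu.comp hγ.continuous.measurable).mul (measurable_deriv _)).aestronglyMeasurable
  · rw [norm_mul]
    exact mul_le_mul (hM _) (abs_deriv_le (hπ.comp hγ) t) (norm_nonneg _)
      ((abs_nonneg _).trans (hM (γ 0)))

theorem ae_differentiableAt_comp (hγ : LipschitzWith K γ) (hπ : LipschitzWith L π) :
    ∀ᵐ t, DifferentiableAt ℝ (π ∘ γ) t :=
  (hπ.comp hγ).ae_differentiableAt_real

/-- A Lipschitz curve carries a finite measure which controls the integration along it, whose
total mass is at most the length, and which ignores a given `ℋ¹`-null set. -/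
theorem exists_measure_enorm_lineIntegral_le [MeasurableSpace X] [BorelSpace X]
    (hγ : LipschitzWith K γ) {N : Set X} (hNm : MeasurableSet N)
    (hN : Measure.hausdorffMeasure 1 N = 0) :
    ∃ μ : Measure X, IsFiniteMeasure μ ∧ μ univ ≤ eVariationOn γ (Icc 0 1) ∧ μ N = 0 ∧
      μ (γ '' Icc 0 1)ᶜ = 0 ∧ ∀ (u π : X → ℝ) (L : ℝ≥0), Measurable u → LipschitzWith L π →
        ‖lineIntegral γ u π‖ₑ ≤ L * ∫⁻ x, ‖u x‖ₑ ∂μ := by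
  obtain ⟨s, hsm, hs, hsd⟩ := exists_speed hγ
  have hγm : Measurable γ := hγ.continuous.measurable
  -- Discarding `γ ⁻¹' N` costs nothing, since the derivatives of `π ∘ γ` vanish there almost
  -- everywhere.
  set P : Set ℝ := Ioc 0 1 \ γ ⁻¹' N
  have hP : MeasurableSet P := measurableSet_Ioc.diff (hγm hNm)
  set μ : Measure X := ((volume.restrict P).withDensity s).map γ
  have hμ : ∀ B, MeasurableSet B → μ B = ∫⁻ t in γ ⁻¹' B ∩ P, s t := fun B hB => by
    rw [Measure.map_apply hγm hB, withDensity_apply _ (hγm hB), Measure.restrict_restrict (hγm hB)]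
  have hμuniv : μ univ ≤ eVariationOn γ (Icc 0 1) := by
    rw [hμ _ MeasurableSet.univ]
    exact (lintegral_mono_set (inter_subset_right.trans sdiff_subset)).trans hs
  have hfin : eVariationOn γ (Icc 0 1) ≠ ∞ := by
    have h := hγ.locallyBoundedVariationOn univ 0 1 (mem_univ _) (mem_univ _)
    rwa [univ_inter] at h
  refine ⟨μ, ⟨hμuniv.trans_lt hfin.lt_top⟩, hμuniv, ?_, ?_, ?_⟩
  · have : γ ⁻¹' N ∩ P = ∅ := by
      ext t; simp [P]
    rw [hμ _ hNm, this]
    simp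
  · have hA : MeasurableSet (γ '' Icc 0 1) :=
      (isCompact_Icc.image hγ.continuous).isClosed.measurableSet
    have : γ ⁻¹' (γ '' Icc 0 1)ᶜ ∩ P = ∅ := by
      refine eq_empty_of_forall_notMem fun t ht => ht.1 ⟨t, ⟨ht.2.1.1.le, ht.2.1.2⟩, rfl⟩
    rw [hμ _ hA.compl, this]
    simp
  · intro u π L hu hπ
    have e1 : ∫⁻ x, ‖u x‖ₑ ∂μ = ∫⁻ t in P, s t * ‖u (γ t)‖ₑ := by
      rw [lintegral_map hu.enorm hγm,
        lintegral_withDensity_eq_lintegral_mul _ hsm (g := fun t => ‖u (γ t)‖ₑ)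
          (hu.comp hγm).enorm]
      rfl
    rw [e1, ← lintegral_const_mul (f := fun t => s t * ‖u (γ t)‖ₑ) _
      (hsm.mul (hu.comp hγm).enorm)]
    refine (enorm_integral_le_lintegral_enorm _).trans ?_
    rw [← lintegral_indicator measurableSet_Ioc, ← lintegral_indicator hP]
    refine lintegral_mono_ae ?_
    filter_upwards [hsd π L hπ, ae_deriv_comp_eq_zero γ hN] with t h1 h2
    by_cases htN : γ t ∈ N
    · by_cases ht : t ∈ Ioc (0 : ℝ) 1 <;> simp [ht, h2 htN π L hπ]
    · by_cases ht : t ∈ Ioc (0 : ℝ) 1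
      · have htP : t ∈ P := ⟨ht, htN⟩
        rw [indicator_of_mem ht, indicator_of_mem htP, enorm_mul, mul_comm, ← mul_assoc]
        gcongr
      · simp [ht]

end CurveIntegral

/-! ### Sums of curves as metric currents -/

section CurveCurrent

variable {N : ℕ}

/-- The sum of the integration currents along finitely many Lipschitz curves. -/
noncomputable def curveCurrent (γ : Fin N → ℝ → X) (hγ : ∀ i, ∃ K : ℝ≥0, LipschitzWith K (γ i)) :
    Functional X 1 :=
  (MultilinearMap.ofSubsingletonₗ ℝ ℝ (Lip X) ℝ (0 : Fin 1)).toLinearMap ∘ₗ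
    LinearMap.mk₂ ℝ (fun (f : LipB X) (π : Lip X) => ∑ i, lineIntegral (γ i) f π)
      (by
        intro f f' π
        obtain ⟨L, hπ⟩ := π.2
        rw [← Finset.sum_add_distrib]
        refine Finset.sum_congr rfl fun i _ => ?_
        obtain ⟨K, hK⟩ := hγ i
        simp only [lineIntegral_eq_intervalIntegral]
        refine Eq.trans ?_ (intervalIntegral.integral_add
          (intervalIntegrable_mul_deriv ((lipB_continuous f).comp hK.continuous) (hπ.comp hK) 0 1)
          (intervalIntegrable_mul_deriv ((lipB_continuous f').comp hK.continuous) (hπ.comp hK) 0 1))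
        refine intervalIntegral.integral_congr fun t _ => ?_
        exact add_mul _ _ _)
      (by
        intro c f π
        rw [smul_eq_mul, Finset.mul_sum]
        refine Finset.sum_congr rfl fun i _ => ?_
        rw [lineIntegral, lineIntegral, ← integral_const_mul]
        refine integral_congr_ae (Eventually.of_forall fun t => ?_)
        exact mul_assoc _ _ _)
      (by
        intro f π π'
        obtain ⟨L, hπ⟩ := π.2
        obtain ⟨L', hπ'⟩ := π'.2
        rw [← Finset.sum_add_distrib]
        refine Finset.sum_congr rfl fun i _ => ?_
        obtain ⟨K, hK⟩ := hγ i
        simp only [lineIntegral_eq_intervalIntegral]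
        refine Eq.trans ?_ (intervalIntegral.integral_add
          (intervalIntegrable_mul_deriv ((lipB_continuous f).comp hK.continuous) (hπ.comp hK) 0 1)
          (intervalIntegrable_mul_deriv ((lipB_continuous f).comp hK.continuous) (hπ'.comp hK) 0 1))
        refine intervalIntegral.integral_congr_ae ?_
        filter_upwards [ae_differentiableAt_comp hK hπ, ae_differentiableAt_comp hK hπ']
          with t h1 h2 _
        rw [← mul_add]
        congr 1
        exact deriv_add h1 h2)
      (by
        intro c f π
        rw [smul_eq_mul, Finset.mul_sum]
        refine Finset.sum_congr rfl fun i _ => ?_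
        rw [lineIntegral, lineIntegral, ← integral_const_mul]
        refine integral_congr_ae (Eventually.of_forall fun t => ?_)
        have : deriv (((c • π : Lip X) : X → ℝ) ∘ γ i) t = c * deriv ((π : X → ℝ) ∘ γ i) t :=
          deriv_const_mul_field c
        simp only [this]
        ring)

variable {γ : Fin N → ℝ → X} {hγ : ∀ i, ∃ K : ℝ≥0, LipschitzWith K (γ i)}

theorem curveCurrent_apply (f : LipB X) (π : Fin 1 → Lip X) :
    curveCurrent γ hγ f π = ∑ i, lineIntegral (γ i) f (π 0) := rfl

theorem boundary_curveCurrent (f : LipB X) (π : Fin 0 → Lip X) :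
    boundary (curveCurrent γ hγ) f π = ∑ i, ((f : X → ℝ) (γ i 1) - (f : X → ℝ) (γ i 0)) := by
  rw [boundary_apply, curveCurrent_apply]
  refine Finset.sum_congr rfl fun i _ => ?_
  obtain ⟨K, hK⟩ := hγ i
  obtain ⟨⟨L, hL⟩, -⟩ := f.2
  rw [lineIntegral_eq_intervalIntegral]
  simp only [LipB.one, one_mul]
  exact integral_deriv_eq_sub_of_lipschitz (hL.comp hK) 0 1

theorem isContinuous_curveCurrent : IsContinuous (curveCurrent γ hγ) := by
  rintro f π π' ⟨K, hK⟩ hlim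
  simp only [curveCurrent_apply, lineIntegral_eq_intervalIntegral]
  refine tendsto_finsetSum _ fun i _ => ?_
  obtain ⟨G, hG⟩ := hγ i
  obtain ⟨⟨L, hL⟩, -⟩ := f.2
  obtain ⟨K', hK'⟩ := (π' 0).2
  refine tendsto_integral_mul_deriv (K := max K K' * G) (hL.comp hG) (fun j => ?_) ?_ fun t => ?_
  · exact ((hK j 0).weaken (le_max_left _ _)).comp hG
  · exact (hK'.weaken (le_max_right _ _)).comp hG
  · exact hlim 0 (γ i t)

/-- In dimension 1 the set `{f ≠ 0}` is open and lies in the single set where `π` is constant, so `π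
∘ γ` is locally constant wherever the integrand could be nonzero. -/
theorem isLocal_curveCurrent [MeasurableSpace X] : IsLocal (curveCurrent γ hγ) := by
  intro f π B _ hfB hconst
  obtain ⟨c, hc⟩ := hconst 0
  rw [curveCurrent_apply]
  refine Finset.sum_eq_zero fun i _ => ?_
  obtain ⟨G, hG⟩ := hγ i
  rw [lineIntegral]
  have : ∀ t, (f : X → ℝ) (γ i t) * deriv ((π 0 : X → ℝ) ∘ γ i) t = 0 := by
    intro t
    by_cases ht : (f : X → ℝ) (γ i t) = 0
    · rw [ht, zero_mul]
    have hev : (π 0 : X → ℝ) ∘ γ i =ᶠ[𝓝 t] fun _ => c := by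
      have hcont : Continuous fun t => (f : X → ℝ) (γ i t) :=
        (lipB_continuous f).comp hG.continuous
      filter_upwards [hcont.continuousAt.eventually_ne ht] with s hs
      refine hc _ ?_
      obtain ⟨j, hj⟩ := mem_iUnion.1 (hfB hs)
      rwa [Subsingleton.elim j 0] at hj
    rw [hev.deriv_eq, deriv_const, mul_zero]
  simp [this]

variable [MeasurableSpace X] [BorelSpace X]

-- The estimate for Borel `u`, beyond the Lipschitz arguments seen by `Controls`, is what identifies
-- the extension to bounded Borel functions later. The freely chosen null set `Z` serves to show
-- that the mass vanishes on it.
variable (γ hγ) in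
theorem exists_measure_enorm_sum_lineIntegral_le {Z : Set X} (hZm : MeasurableSet Z)
    (hZ : Measure.hausdorffMeasure 1 Z = 0) :
    ∃ μ : Measure X, IsFiniteMeasure μ ∧ μ univ ≤ ∑ i, eVariationOn (γ i) (Icc 0 1) ∧ μ Z = 0 ∧
      μ (⋃ i, γ i '' Icc 0 1)ᶜ = 0 ∧ Controls (curveCurrent γ hγ) μ ∧
      ∀ (u π : X → ℝ) (L : ℝ≥0), Measurable u → LipschitzWith L π →
        ‖∑ i, lineIntegral (γ i) u π‖ₑ ≤ L * ∫⁻ x, ‖u x‖ₑ ∂μ := by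
  have h := fun i => exists_measure_enorm_lineIntegral_le (hγ i).choose_spec hZm hZ
  choose μ hfin hlen hμZ hμA hμ using h
  have hb : ∀ (u π : X → ℝ) (L : ℝ≥0), Measurable u → LipschitzWith L π →
        ‖∑ i, lineIntegral (γ i) u π‖ₑ ≤ L * ∫⁻ x, ‖u x‖ₑ ∂(∑ i, μ i) := by
    intro u π L hu hπ
    rw [lintegral_finsetSum_measure, Finset.mul_sum]
    exact (enorm_sum_le _ _).trans (Finset.sum_le_sum fun i _ => hμ i u π L hu hπ)
  refine ⟨∑ i, μ i, inferInstance, ?_, ?_, ?_, ?_, hb⟩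
  · rw [Measure.finsetSum_apply]
    exact Finset.sum_le_sum fun i _ => hlen i
  · rw [Measure.finsetSum_apply]
    exact Finset.sum_eq_zero fun i _ => hμZ i
  · rw [Measure.finsetSum_apply]
    refine Finset.sum_eq_zero fun i _ => measure_mono_null ?_ (hμA i)
    exact compl_subset_compl.2 (subset_iUnion (fun i => γ i '' Icc 0 1) i)
  · intro f π K hK
    have h := hb f (π 0) (K 0) (lipB_continuous f).measurable (hK 0)
    rw [curveCurrent_apply, Fin.prod_univ_one]
    have e : ∫⁻ x, ‖(f : X → ℝ) x‖ₑ ∂(∑ i, μ i) =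
        ENNReal.ofReal (∫ x, |(f : X → ℝ) x| ∂(∑ i, μ i)) :=
      (ofReal_integral_norm_eq_lintegral_enorm (lipB_integrable f _)).symm
    rw [e, Real.enorm_eq_ofReal_abs, ← ENNReal.ofReal_coe_nnreal,
      ← ENNReal.ofReal_mul (NNReal.coe_nonneg _)] at h
    exact (ENNReal.ofReal_le_ofReal_iff
      (mul_nonneg (NNReal.coe_nonneg _) (integral_nonneg fun _ => abs_nonneg _))).1 h

theorem isCurrent_curveCurrent : IsCurrent (curveCurrent γ hγ) where
  continuous := isContinuous_curveCurrent
  isLocal := isLocal_curveCurrent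
  finiteMass := by
    obtain ⟨μ, h1, -, -, -, h2, -⟩ :=
      exists_measure_enorm_sum_lineIntegral_le γ hγ MeasurableSet.empty (by simp)
    exact ⟨μ, h1, h2⟩

theorem mass_curveCurrent_le : mass (curveCurrent γ hγ) ≤ ∑ i, eVariationOn (γ i) (Icc 0 1) := by
  obtain ⟨μ, h1, h3, -, -, h2, -⟩ :=
    exists_measure_enorm_sum_lineIntegral_le γ hγ MeasurableSet.empty (by simp)
  exact (massMeasure_le h2 univ).trans h3

theorem hasFiniteMass_boundary_curveCurrent : HasFiniteMass (boundary (curveCurrent γ hγ)) := by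
  refine ⟨∑ i, (Measure.dirac (γ i 1) + Measure.dirac (γ i 0)), inferInstance, fun f π K _ => ?_⟩
  rw [boundary_curveCurrent, Fin.prod_univ_zero, one_mul,
    integral_finsetSum_measure fun i _ => (lipB_integrable f _).abs]
  refine (Finset.abs_sum_le_sum_abs _ _).trans (Finset.sum_le_sum fun i _ => ?_)
  rw [integral_add_measure (lipB_integrable f _).abs (lipB_integrable f _).abs,
    integral_dirac' _ _ (lipB_continuous f).abs.stronglyMeasurable,
    integral_dirac' _ _ (lipB_continuous f).abs.stronglyMeasurable]
  exact abs_sub _ _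

theorem isCountablyRectifiable_iUnion_image (hγ : ∀ i, ∃ K : ℝ≥0, LipschitzWith K (γ i)) :
    IsCountablyRectifiable 1 (⋃ i, γ i '' Icc 0 1) := by
  constructor
  · have hA : MeasurableSet (⋃ i, γ i '' Icc 0 1) := by
      refine MeasurableSet.iUnion fun i => ?_
      obtain ⟨K, hK⟩ := hγ i
      exact (isCompact_Icc.image hK.continuous).isClosed.measurableSet
    exact le_toOuterMeasure_caratheodory _ _ hA
  -- The domains are the whole line for `n < N` and empty afterwards, so finitely many curves fill a
  -- sequence indexed by `ℕ`.
  · refine ⟨fun n => {_p | n < N}, fun n p => γ ⟨n, p.2⟩ (p.1 0), fun n => ?_, ?_⟩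
    · by_cases hn : n < N
      · obtain ⟨K, hK⟩ := hγ ⟨n, hn⟩
        refine ⟨K, LipschitzWith.of_dist_le_mul fun p q => ?_⟩
        refine (hK.dist_le_mul _ _).trans ?_
        gcongr
        rw [Subtype.dist_eq, EuclideanSpace.dist_eq]
        refine Real.le_sqrt_of_sq_le ?_
        simp
      · exact ⟨0, fun p => absurd p.2 hn⟩
    · have : (⋃ i, γ i '' Icc 0 1) \ ⋃ n : ℕ, range (fun p : {_p : EuclideanSpace ℝ (Fin 1) | n < N} =>
          γ ⟨n, p.2⟩ (p.1 0)) = ∅ := by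
        rw [sdiff_eq_empty]
        rintro _ ⟨_, ⟨i, rfl⟩, t, -, rfl⟩
        refine mem_iUnion.2 ⟨i, ⟨⟨EuclideanSpace.single 0 t, i.2⟩, ?_⟩⟩
        simp
      rw [this, measure_empty]

end CurveCurrent

/-! ### Restrictions, push-forwards and integrality of curve currents -/

section IntegerMultiplicity

variable [MeasurableSpace X] [BorelSpace X] {N : ℕ}
  {γ : Fin N → ℝ → X} {hγ : ∀ i, ∃ K : ℝ≥0, LipschitzWith K (γ i)}

theorem enorm_le_of_controls {k : ℕ} {T : Functional X k} {μ : Measure X} [IsFiniteMeasure μ]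
    (hT : Controls T μ) (f : LipB X) {π : Fin k → Lip X} {K : Fin k → ℝ≥0}
    (hK : ∀ i, LipschitzWith (K i) (π i : X → ℝ)) :
    ‖T f π‖ₑ ≤ (∏ i, K i : ℝ≥0) * ∫⁻ x, ‖(f : X → ℝ) x‖ₑ ∂μ := by
  have e : ∫⁻ x, ‖(f : X → ℝ) x‖ₑ ∂μ = ENNReal.ofReal (∫ x, |(f : X → ℝ) x| ∂μ) :=
    (ofReal_integral_norm_eq_lintegral_enorm (lipB_integrable f _)).symm
  rw [e, Real.enorm_eq_ofReal_abs, ← ENNReal.ofReal_coe_nnreal,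
    ← ENNReal.ofReal_mul (NNReal.coe_nonneg _), NNReal.coe_prod]
  exact ENNReal.ofReal_le_ofReal (hT f π K hK)

theorem sum_lineIntegral_sub (hγ : ∀ i, ∃ K : ℝ≥0, LipschitzWith K (γ i)) {u w π : X → ℝ}
    {L : ℝ≥0} (hπ : LipschitzWith L π) (hu : Measurable u) (hw : Measurable w) {M M' : ℝ}
    (hM : ∀ x, |u x| ≤ M) (hM' : ∀ x, |w x| ≤ M') :
    ∑ i, lineIntegral (γ i) u π - ∑ i, lineIntegral (γ i) w π =
      ∑ i, lineIntegral (γ i) (u - w) π := by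
  rw [← Finset.sum_sub_distrib]
  refine Finset.sum_congr rfl fun i _ => ?_
  obtain ⟨K, hK⟩ := hγ i
  refine (integral_sub (integrableOn_lineIntegral hK hπ hu hM)
    (integrableOn_lineIntegral hK hπ hw hM')).symm.trans ?_
  refine integral_congr_ae (Eventually.of_forall fun t => ?_)
  exact (sub_mul _ _ _).symm

/-- The `L¹`-extension of a curve current is given by the same formula. -/
theorem extend_curveCurrent {u : X → ℝ} (hu : Measurable u) {M : ℝ} (hM : ∀ x, |u x| ≤ M)
    (π : Fin 1 → Lip X) :
    extend (curveCurrent γ hγ) u π = ∑ i, lineIntegral (γ i) u (π 0) := by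
  obtain ⟨μ, hμf, -, -, -, hμc, hμ⟩ :=
    exists_measure_enorm_sum_lineIntegral_le γ hγ MeasurableSet.empty (by simp)
  set ν := massMeasure (curveCurrent γ hγ)
  have hfm : HasFiniteMass (curveCurrent γ hγ) := ⟨μ, hμf, hμc⟩
  have hνf : IsFiniteMeasure ν := isFiniteMeasure_massMeasure hfm
  have hν : Controls (curveCurrent γ hγ) ν := controls_massMeasure hfm
  have hνμ : ν ≤ μ := massMeasure_le hμc
  obtain ⟨L, hL⟩ := (π 0).2
  have hLi : ∀ i, LipschitzWith ((fun _ => L) i) (π i : X → ℝ) := fun i => by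
    rwa [Subsingleton.elim i 0]
  have hdense : ∀ ε : ℝ≥0∞, ε ≠ 0 → ∃ g : LipB X, ∫⁻ x, ‖(g : X → ℝ) x - u x‖ₑ ∂μ ≤ ε := by
    intro ε hε
    have huL : MemLp u 1 μ := MemLp.of_bound hu.aestronglyMeasurable M (Eventually.of_forall hM)
    obtain ⟨g, hg⟩ := exists_lipB_eLpNorm_sub_le μ ENNReal.one_ne_top huL hε
    refine ⟨g, ?_⟩
    rw [eLpNorm_sub_comm, eLpNorm_one_eq_lintegral_enorm] at hg
    exact hg
  have hbound : ∀ f : LipB X,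
      ‖curveCurrent γ hγ f π - ∑ i, lineIntegral (γ i) u (π 0)‖ₑ ≤
        L * ∫⁻ x, ‖(f : X → ℝ) x - u x‖ₑ ∂ν := by
    intro f
    have key : ∀ ε : ℝ≥0, 0 < ε →
        ‖curveCurrent γ hγ f π - ∑ i, lineIntegral (γ i) u (π 0)‖ₑ ≤
          L * ∫⁻ x, ‖(f : X → ℝ) x - u x‖ₑ ∂ν + (2 * L) * ε := by
      intro ε hε
      -- For Borel arguments the line integral is bounded by `μ`, not yet by the smaller `ν`. An
      -- intermediate Lipschitz `g` close to `u` in `L¹(μ)` splits the error: `f - g` is estimated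
      -- with `ν`, and `g - u` with `μ`.
      obtain ⟨g, hg⟩ := hdense ε (by exact_mod_cast hε.ne')
      obtain ⟨Mg, hMg⟩ := lipB_exists_bound g
      have h1 : curveCurrent γ hγ f π - ∑ i, lineIntegral (γ i) u (π 0) =
          curveCurrent γ hγ (f - g) π + ∑ i, lineIntegral (γ i) ((g : X → ℝ) - u) (π 0) := by
        rw [← sum_lineIntegral_sub hγ hL (lipB_continuous g).measurable hu hMg hM, map_sub,
          ← curveCurrent_apply (hγ := hγ) g π]
        simp
      have h2 : ‖curveCurrent γ hγ (f - g) π‖ₑ ≤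
          L * (∫⁻ x, ‖(f : X → ℝ) x - u x‖ₑ ∂ν + ε) := by
        have := enorm_le_of_controls hν (f - g) hLi
        simp only [Finset.prod_const, Finset.card_univ, Fintype.card_fin, pow_one] at this
        refine this.trans ?_
        gcongr
        calc ∫⁻ x, ‖((f - g : LipB X) : X → ℝ) x‖ₑ ∂ν
            ≤ ∫⁻ x, (‖(f : X → ℝ) x - u x‖ₑ + ‖(g : X → ℝ) x - u x‖ₑ) ∂ν := by
              refine lintegral_mono fun x => ?_
              have : ((f - g : LipB X) : X → ℝ) x =
                ((f : X → ℝ) x - u x) - ((g : X → ℝ) x - u x) := (sub_sub_sub_cancel_right _ _ _).symm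
              rw [this]
              exact enorm_sub_le
          _ = ∫⁻ x, ‖(f : X → ℝ) x - u x‖ₑ ∂ν + ∫⁻ x, ‖(g : X → ℝ) x - u x‖ₑ ∂ν :=
              lintegral_add_left ((lipB_continuous f).measurable.sub hu).enorm _
          _ ≤ _ := by
              gcongr
              exact (lintegral_mono' hνμ le_rfl).trans hg
      have h3 : ‖∑ i, lineIntegral (γ i) ((g : X → ℝ) - u) (π 0)‖ₑ ≤ L * ε := by
        refine (hμ _ _ L ((lipB_continuous g).measurable.sub hu) hL).trans ?_
        gcongr
        exact hg
      rw [h1]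
      refine (enorm_add_le _ _).trans ((add_le_add h2 h3).trans_eq ?_)
      ring
    refine ENNReal.le_of_forall_pos_le_add fun ε hε _ => ?_
    refine (key (ε / (2 * L + 1)) (by positivity)).trans (add_le_add_right ?_ _)
    have hle : 2 * L * (ε / (2 * L + 1)) ≤ ε := by
      rw [mul_div_assoc', div_le_iff₀ (by positivity), mul_comm]
      exact mul_le_mul_right (le_add_of_nonneg_right zero_le) ε
    exact_mod_cast hle
  -- The filter defining the extension must be nontrivial for the limit to be unique.
  have hne : (comap (fun f : LipB X => ∫⁻ x, ‖(f : X → ℝ) x - u x‖ₑ ∂ν) (𝓝 0)).NeBot := by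
    rw [comap_neBot_iff]
    intro t ht
    obtain ⟨ε, hε, hεt⟩ := ENNReal.nhds_zero_basis_Iic.mem_iff.1 ht
    obtain ⟨g, hg⟩ := hdense ε hε.ne'
    exact ⟨g, hεt ((lintegral_mono' hνμ le_rfl).trans hg)⟩
  refine Tendsto.limUnder_eq ?_
  rw [tendsto_iff_edist_tendsto_0]
  have ht : Tendsto (fun f : LipB X => (L : ℝ≥0∞) * ∫⁻ x, ‖(f : X → ℝ) x - u x‖ₑ ∂ν)
      (comap (fun f : LipB X => ∫⁻ x, ‖(f : X → ℝ) x - u x‖ₑ ∂ν) (𝓝 0)) (𝓝 0) := by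
    have := ENNReal.Tendsto.const_mul (a := (L : ℝ≥0∞))
      (tendsto_comap (f := fun f : LipB X => ∫⁻ x, ‖(f : X → ℝ) x - u x‖ₑ ∂ν) (x := 𝓝 0))
      (Or.inr ENNReal.coe_ne_top)
    rwa [mul_zero] at this
  refine tendsto_of_tendsto_of_tendsto_of_le_of_le tendsto_const_nhds ht (fun _ => zero_le) fun f => ?_
  rw [edist_eq_enorm_sub]
  exact hbound f

/-- The isometry between `ℝ` and the one-dimensional Euclidean space. -/
noncomputable def realIsometry : ℝ ≃ₗᵢ[ℝ] EuclideanSpace ℝ (Fin 1) where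
  toFun x := EuclideanSpace.single 0 x
  invFun p := p 0
  map_add' x y := by ext i; simp [Subsingleton.elim i 0]
  map_smul' c x := by ext i; simp [Subsingleton.elim i 0]
  left_inv x := by simp
  right_inv p := by ext i; simp [Subsingleton.elim i 0]
  norm_map' x := PiLp.norm_single 2 (fun _ => ℝ) 0 x

theorem realIsometry_apply_zero (x : ℝ) : realIsometry x 0 = x :=
  realIsometry.symm_apply_apply x

theorem realIsometry_zero_apply (p : EuclideanSpace ℝ (Fin 1)) : realIsometry (p 0) = p := by
  ext i
  rw [Subsingleton.elim i 0, realIsometry_apply_zero]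

theorem fderiv_single_eq_deriv (π : EuclideanSpace ℝ (Fin 1) → ℝ) (x : ℝ) :
    fderiv ℝ π (realIsometry x) (EuclideanSpace.single 0 1) = deriv (π ∘ realIsometry) x := by
  have h : EuclideanSpace.single 0 1 = realIsometry 1 := by
    ext i
    rw [Subsingleton.elim i 0, realIsometry_apply_zero]
    simp
  have h2 := realIsometry.toContinuousLinearEquiv.comp_right_fderiv (f := π) (x := x)
  rw [← fderiv_apply_one_eq_deriv, h]
  have h3 := congrArg (fun ψ => ψ 1) h2
  exact h3.symm

theorem euclideanCurrent_one (θ : ℝ → ℤ) (f : LipB (EuclideanSpace ℝ (Fin 1)))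
    (π : Fin 1 → Lip (EuclideanSpace ℝ (Fin 1))) :
    euclideanCurrent (fun p => θ (p 0)) f π =
      ∫ x, (θ x : ℝ) * (f.1 (realIsometry x) * deriv ((π 0).1 ∘ realIsometry) x) := by
  have hmp : MeasurePreserving realIsometry :=
    realIsometry.measurePreserving
  rw [euclideanCurrent, ← hmp.integral_comp realIsometry.toHomeomorph.measurableEmbedding]
  refine integral_congr_ae (Eventually.of_forall fun x => ?_)
  simp only [realIsometry_apply_zero, Matrix.det_fin_one, Matrix.of_apply]
  rw [fderiv_single_eq_deriv, mul_assoc]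

/-- Restricting to `U` means integrating over the open parameter set where `γ i` lies in `U`; its
image under the real function `φ ∘ γ i` has an integer multiplicity, and these add up over `i`. -/
theorem exists_integer_multiplicity_curveCurrent (φ : X → EuclideanSpace ℝ (Fin 1))
    (hφ : ∃ K : ℝ≥0, LipschitzWith K φ) {U : Set X} (hU : IsOpen U) :
    ∃ θ : EuclideanSpace ℝ (Fin 1) → ℤ, Integrable (fun x => (θ x : ℝ)) ∧
      ∀ f π, pushforward (restrict (curveCurrent γ hγ) U) φ hφ f π = euclideanCurrent θ f π := by
  obtain ⟨G, hG⟩ := hφ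
  have hh : ∀ i, ∃ K : ℝ≥0, LipschitzWith K fun t => realIsometry.symm (φ (γ i t)) := fun i => by
    obtain ⟨K, hK⟩ := hγ i
    exact ⟨_, realIsometry.symm.lipschitz.comp (hG.comp hK)⟩
  have hW : ∀ i, IsOpen (Ioo (0 : ℝ) 1 ∩ γ i ⁻¹' U) := fun i => by
    obtain ⟨K, hK⟩ := hγ i
    exact isOpen_Ioo.inter (hU.preimage hK.continuous)
  have hex := fun i => exists_multiplicity (hh i).choose_spec (hW i) (c := 0) (d := 1)
    (inter_subset_left.trans Ioo_subset_Icc_self)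
  choose θ hθi hθ using hex
  have hmp : MeasurePreserving realIsometry.symm := realIsometry.symm.measurePreserving
  have hsymm : ∀ p : EuclideanSpace ℝ (Fin 1), realIsometry.symm p = p 0 := fun p => by
    rw [LinearIsometryEquiv.symm_apply_eq, realIsometry_zero_apply]
  refine ⟨fun p => ∑ i, θ i (p 0), ?_, fun f π => ?_⟩
  · push_cast
    refine integrable_finsetSum _ fun i _ => ?_
    refine ((hmp.integrable_comp_emb realIsometry.symm.toHomeomorph.measurableEmbedding).2
      (hθi i)).congr (Eventually.of_forall fun p => ?_)
    simp only [Function.comp_apply, hsymm]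
  · obtain ⟨⟨A, hA⟩, M, hM⟩ := f.2
    obtain ⟨B, hB⟩ := (π 0).2
    have hfι := hA.comp realIsometry.lipschitz
    have hπι := hB.comp realIsometry.lipschitz
    have hb : ∀ x, ‖f.1 (realIsometry x) * deriv ((π 0).1 ∘ realIsometry) x‖ ≤ M * (B * 1 : ℝ≥0) :=
      fun x => by
        rw [norm_mul]
        exact mul_le_mul (hM _) (abs_deriv_le hπι x) (norm_nonneg _)
          ((abs_nonneg _).trans (hM 0))
    have hint : ∀ i, Integrable fun x =>
        (θ i x : ℝ) * (f.1 (realIsometry x) * deriv ((π 0).1 ∘ realIsometry) x) := fun i =>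
      (hθi i).mul_bdd
        (hfι.continuous.measurable.mul (measurable_deriv _)).aestronglyMeasurable
        (Eventually.of_forall hb)
    rw [euclideanCurrent_one (fun x => ∑ i, θ i x)]
    push_cast
    simp only [Finset.sum_mul]
    rw [integral_finsetSum _ fun i _ => hint i]
    have hMU : ∀ x, |U.indicator (fun x => f.1 (φ x)) x| ≤ M := fun x => by
      by_cases hx : x ∈ U
      · simpa [hx] using hM (φ x)
      · simpa [hx] using (abs_nonneg _).trans (hM 0)
    have hmU : Measurable (U.indicator fun x => f.1 (φ x)) :=
      (hA.comp hG).continuous.measurable.indicator hU.measurableSet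
    refine (extend_curveCurrent hmU hMU _).trans (Finset.sum_congr rfl fun i _ => ?_)
    refine Eq.trans ?_ (hθ i _ _ _ _ M hfι hπι fun x => hM _)
    rw [lineIntegral,
      setIntegral_congr_set (Ioo_ae_eq_Ioc (μ := volume) (a := (0 : ℝ)) (b := 1)).symm]
    have hmW : MeasurableSet (γ i ⁻¹' U) := by
      obtain ⟨K, hK⟩ := hγ i
      exact (hU.preimage hK.continuous).measurableSet
    rw [← setIntegral_indicator hmW]
    refine integral_congr_ae (Eventually.of_forall fun t => ?_)
    have hc : (π 0).1 ∘ realIsometry ∘ (fun t => realIsometry.symm (φ (γ i t))) =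
        (π 0).1 ∘ φ ∘ γ i := by
      funext s; simp
    by_cases ht : γ i t ∈ U
    · have ht' : t ∈ γ i ⁻¹' U := ht
      simp only [indicator_of_mem ht, indicator_of_mem ht', Function.comp_assoc, hc]
      simp [Function.comp_def, Lip.comp]
    · have ht' : t ∉ γ i ⁻¹' U := ht
      simp only [indicator_of_notMem ht, indicator_of_notMem ht', zero_mul]

theorem isIntegral_curveCurrent : IsIntegral (curveCurrent γ hγ) := by
  refine ⟨isCurrent_curveCurrent, ⟨⟨⋃ i, γ i '' Icc 0 1,
    isCountablyRectifiable_iUnion_image hγ, ?_⟩, fun Z hZ => ?_,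
    fun φ hφ U hU => exists_integer_multiplicity_curveCurrent φ hφ hU⟩,
    hasFiniteMass_boundary_curveCurrent⟩
  · obtain ⟨μ, h1, -, -, h3, h2, -⟩ :=
      exists_measure_enorm_sum_lineIntegral_le γ hγ MeasurableSet.empty (by simp)
    exact le_antisymm ((massMeasure_le h2 _).trans_eq h3) zero_le
  · rw [Nat.cast_one] at hZ
    -- The null set need not be Borel, so it is replaced by a measurable hull.
    have hZ' : Measure.hausdorffMeasure 1 (toMeasurable (Measure.hausdorffMeasure 1) Z) = 0 := by
      rwa [measure_toMeasurable]
    obtain ⟨μ, h1, -, h3, -, h2, -⟩ :=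
      exists_measure_enorm_sum_lineIntegral_le γ hγ (measurableSet_toMeasurable _ Z) hZ'
    exact measure_mono_null (subset_toMeasurable _ Z)
      (le_antisymm ((massMeasure_le h2 _).trans_eq h3) zero_le)

end IntegerMultiplicity

/-! ### Filling by curves and the hard implication -/

section Filling

/-- In a quasiconvex space nearby points are joined by short curves, parametrized by `ℝ`. -/
theorem exists_lipschitz_curve {δ C : ℝ}
    (h : ∀ x y : X, dist x y ≤ δ →
      ∃ γ : ℝ → X, (∃ K : ℝ≥0, LipschitzOnWith K γ (Icc 0 1)) ∧ γ 0 = x ∧ γ 1 = y ∧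
        eVariationOn γ (Icc 0 1) ≤ ENNReal.ofReal (C * dist x y))
    {x y : X} (hxy : dist x y ≤ δ) :
    ∃ γ : ℝ → X, (∃ K : ℝ≥0, LipschitzWith K γ) ∧ γ 0 = x ∧ γ 1 = y ∧
      eVariationOn γ (Icc 0 1) ≤ ENNReal.ofReal (C * dist x y) := by
  obtain ⟨γ, ⟨K, hK⟩, h0, h1, hl⟩ := h x y hxy
  have heq : EqOn (fun t => γ (projIcc (0 : ℝ) 1 zero_le_one t)) γ (Icc 0 1) := fun t ht => by
    simp only [projIcc_of_mem zero_le_one ht]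
  refine ⟨fun t => γ (projIcc (0 : ℝ) 1 zero_le_one t), ⟨K * 1, ?_⟩, ?_, ?_, ?_⟩
  · exact hK.to_restrict.comp (LipschitzWith.projIcc zero_le_one)
  · exact (heq ⟨le_rfl, zero_le_one⟩).trans h0
  · exact (heq ⟨zero_le_one, le_rfl⟩).trans h1
  · rwa [eVariationOn.congr heq]

theorem exists_fin_sum_eq_multiset_sum {α : Type*} {N : ℕ} (P : Multiset α)
    (hP : Multiset.card P = N) :
    ∃ x : Fin N → α, ∀ f : α → ℝ, ∑ i, f (x i) = (P.map f).sum := by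
  subst hP
  induction P using Quotient.inductionOn with
  | h l => exact ⟨fun i => l[i], fun f => Fin.sum_univ_fun_getElem l f⟩

variable [MeasurableSpace X] [BorelSpace X]

/-- A `0`-dimensional integral current is a difference of two finite sums of point evaluations,
whose number is at most the mass. -/
theorem IsIntegral.exists_multisets {T : Functional X 0} (hT : IsIntegral T) :
    ∃ P Q : Multiset X, (∀ (f : LipB X) (π : Fin 0 → Lip X),
        T f π = (P.map (f : X → ℝ)).sum - (Q.map (f : X → ℝ)).sum) ∧
      ((Multiset.card P + Multiset.card Q : ℕ) : ℝ≥0∞) ≤ mass T := by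
  obtain ⟨c, hc⟩ := hT.2.exists_finsupp
  have hmass := natAbs_sum_le_mass hT.1.finiteMass hc
  -- Positive and negative parts of the coefficients, listed with multiplicity.
  refine ⟨∑ x ∈ c.support, Multiset.replicate (c x).toNat x,
    ∑ x ∈ c.support, Multiset.replicate (-c x).toNat x, fun f π => ?_, ?_⟩
  · have hsum : ∀ n : X → ℕ, ((∑ x ∈ c.support, Multiset.replicate (n x) x).map (f : X → ℝ)).sum =
        ∑ x ∈ c.support, n x * (f : X → ℝ) x := fun n => by
      have := map_sum (Multiset.sumAddMonoidHom.comp (Multiset.mapAddMonoidHom (f : X → ℝ)))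
        (fun x => Multiset.replicate (n x) x) c.support
      refine this.trans (Finset.sum_congr rfl fun x _ => ?_)
      change ((Multiset.replicate (n x) x).map (f : X → ℝ)).sum = _
      rw [Multiset.map_replicate, Multiset.sum_replicate, nsmul_eq_mul]
    rw [hc, hsum, hsum, Finsupp.sum, ← Finset.sum_sub_distrib]
    refine Finset.sum_congr rfl fun x _ => ?_
    rw [← sub_mul]
    congr 1
    have := Int.toNat_sub_toNat_neg (c x)
    exact_mod_cast this.symm
  · refine le_trans (le_of_eq ?_) hmass
    congr 1
    rw [Multiset.card_sum, Multiset.card_sum, ← Finset.sum_add_distrib, Finsupp.sum]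
    refine Finset.sum_congr rfl fun x _ => ?_
    rw [Multiset.card_replicate, Multiset.card_replicate]
    omega

theorem fillvol_le_of_curves {N : ℕ} {S : Functional X 0} (γ : Fin N → ℝ → X)
    (hγ : ∀ i, ∃ K : ℝ≥0, LipschitzWith K (γ i))
    (hS : ∀ (f : LipB X) (π : Fin 0 → Lip X),
      S f π = ∑ i, ((f : X → ℝ) (γ i 1) - (f : X → ℝ) (γ i 0))) :
    fillvol S ≤ ∑ i, eVariationOn (γ i) (Icc 0 1) := by
  have hb : boundary (curveCurrent γ hγ) = S := by
    ext f π
    rw [boundary_curveCurrent, hS]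
  exact (iInf₂_le (curveCurrent γ hγ) ⟨isIntegral_curveCurrent, hb⟩).trans mass_curveCurrent_le

theorem tendsto_fillvol_of_weaklyConverges [CompleteSpace X] (hX : IsQuasiconvex X)
    {T : Functional X 0} (hT : IsIntegral T) {Tm : ℕ → Functional X 0}
    (hTm : ∀ m, IsIntegral (Tm m)) (hbdd : ∃ B : ℝ≥0, ∀ m, mass (Tm m) ≤ B)
    (h : WeaklyConverges Tm T) : Tendsto (fun m => fillvol (T - Tm m)) atTop (𝓝 0) := by
  -- Padding needs a base point, so the empty space is treated apart.
  rcases isEmpty_or_nonempty X with hXe | ⟨⟨x₀⟩⟩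
  · have : ∀ m, fillvol (T - Tm m) = 0 := fun m => by
      refine le_antisymm ((fillvol_le_of_curves (N := 0) Fin.elim0 (fun i => i.elim0)
        fun f π => ?_).trans_eq (by simp)) zero_le
      have : f = 0 := Subtype.ext (Subsingleton.elim _ _)
      simp [this]
    simp [this]
  obtain ⟨δ, hδ, C, hC⟩ := hX
  obtain ⟨B, hB⟩ := hbdd
  obtain ⟨P, Q, hPQ, -⟩ := hT.exists_multisets
  choose P' Q' hPQ' hcard' using fun m => (hTm m).exists_multisets
  obtain ⟨n, hn⟩ := exists_nat_ge B
  set N := Multiset.card P + Multiset.card Q + n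
  have hcard : ∀ m, Multiset.card (P' m) + Multiset.card (Q' m) ≤ n := fun m => by
    have h1 : ((Multiset.card (P' m) + Multiset.card (Q' m) : ℕ) : ℝ≥0∞) ≤ ((n : ℝ≥0) : ℝ≥0∞) :=
      ((hcard' m).trans (hB m)).trans (ENNReal.coe_le_coe.2 hn)
    exact_mod_cast h1
  have hdiff : ∀ m (f : LipB X) (π : Fin 0 → Lip X), (T - Tm m) f π =
      ((P + Q' m).map (f : X → ℝ)).sum - ((Q + P' m).map (f : X → ℝ)).sum := fun m f π => by
    have : (T - Tm m) f π = T f π - Tm m f π := rfl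
    rw [this, hPQ, hPQ']
    simp only [Multiset.map_add, Multiset.sum_add]
    ring
  have hlim : ∀ f : LipB X, Tendsto (fun m => (T - Tm m) f Fin.elim0) atTop (𝓝 0) := fun f => by
    have := (h f Fin.elim0).const_sub (T f Fin.elim0)
    rwa [sub_self] at this
  -- The value at the constant 1 is the difference of the two cardinalities, an integer tending to
  -- 0.
  have hbal : ∀ᶠ m in atTop, Multiset.card (P + Q' m) = Multiset.card (Q + P' m) := by
    have h1 := Metric.tendsto_nhds.1 (hlim (LipB.one X)) 1 one_pos
    filter_upwards [h1] with m hm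
    rw [hdiff, Real.dist_eq, sub_zero] at hm
    simp only [LipB.one, Multiset.map_const', Multiset.sum_replicate, nsmul_eq_mul, mul_one] at hm
    have h2 : |((Multiset.card (P + Q' m) : ℤ) - (Multiset.card (Q + P' m) : ℤ))| < 1 := by
      exact_mod_cast hm
    have := Int.abs_lt_one_iff.1 h2
    omega
  -- Adding copies of `x₀` on both sides leaves the difference unchanged and makes the number of
  -- points `N` for every balanced `m`; unbalanced `m` get a default value.
  have hxy : ∀ m, ∃ x y : Fin N → X,
      Multiset.card (P + Q' m) = Multiset.card (Q + P' m) → ∀ f : X → ℝ,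
        ∑ i, (f (x i) - f (y i)) = ((P + Q' m).map f).sum - ((Q + P' m).map f).sum := by
    intro m
    by_cases hm : Multiset.card (P + Q' m) = Multiset.card (Q + P' m)
    · have hle : Multiset.card (P + Q' m) ≤ N := by
        have := hcard m
        rw [Multiset.card_add]
        omega
      obtain ⟨x, hx⟩ := exists_fin_sum_eq_multiset_sum (N := N)
        (P + Q' m + Multiset.replicate (N - Multiset.card (P + Q' m)) x₀) (by
          rw [Multiset.card_add, Multiset.card_replicate]; omega)
      obtain ⟨y, hy⟩ := exists_fin_sum_eq_multiset_sum (N := N)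
        (Q + P' m + Multiset.replicate (N - Multiset.card (P + Q' m)) x₀) (by
          rw [Multiset.card_add, Multiset.card_replicate]; omega)
      refine ⟨x, y, fun _ f => ?_⟩
      rw [Finset.sum_sub_distrib, hx, hy, Multiset.map_add, Multiset.map_add _ (Q + P' m),
        Multiset.sum_add, Multiset.sum_add]
      ring
    · exact ⟨fun _ => x₀, fun _ => x₀, fun h => absurd h hm⟩
  choose x y hxy using hxy
  have hweak : ∀ f : LipB X,
      Tendsto (fun m => ∑ i, ((f : X → ℝ) (x m i) - (f : X → ℝ) (y m i))) atTop (𝓝 0) := fun f => by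
    refine (hlim f).congr' ?_
    filter_upwards [hbal] with m hm
    rw [hdiff, hxy m hm]
  refine ENNReal.tendsto_nhds_zero.2 fun ε hε => ?_
  -- `N` curves, each of length at most `|C| * η`; the absolute value is taken because `C` may be
  -- negative.
  have hη : ∀ᶠ η : ℝ in 𝓝[>] 0, (N : ℝ≥0∞) * ENNReal.ofReal (|C| * η) ≤ ε := by
    have h1 : Tendsto (fun η : ℝ => (N : ℝ≥0∞) * ENNReal.ofReal (|C| * η)) (𝓝 0)
        (𝓝 ((N : ℝ≥0∞) * ENNReal.ofReal (|C| * 0))) := by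
      refine ENNReal.Tendsto.const_mul ?_ (Or.inr (ENNReal.natCast_ne_top N))
      exact ENNReal.tendsto_ofReal (tendsto_id.const_mul |C|)
    rw [mul_zero, ENNReal.ofReal_zero, mul_zero] at h1
    exact nhdsWithin_le_nhds (h1.eventually (ge_mem_nhds hε))
  obtain ⟨η, ⟨hηε, hηδ⟩, hη0⟩ :=
    ((hη.and (nhdsWithin_le_nhds (gt_mem_nhds hδ))).and self_mem_nhdsWithin).exists
  filter_upwards [eventually_exists_perm_dist_lt x y hweak hη0, hbal] with m ⟨σ, hσ⟩ hm
  have hcurve := fun i => exists_lipschitz_curve hC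
    (x := y m (σ i)) (y := x m i) (by rw [dist_comm]; exact ((hσ i).trans hηδ).le)
  choose γ hγ h0 h1 hlen using hcurve
  refine (fillvol_le_of_curves γ hγ fun f π => ?_).trans ?_
  · simp only [h0, h1]
    rw [hdiff, ← hxy m hm, Finset.sum_sub_distrib, Finset.sum_sub_distrib,
      Equiv.sum_comp σ fun i => (f : X → ℝ) (y m i)]
  · refine (Finset.sum_le_sum (g := fun _ => ENNReal.ofReal (|C| * η)) fun i _ => ?_).trans ?_
    · refine (hlen i).trans (ENNReal.ofReal_le_ofReal ?_)
      rw [dist_comm]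
      exact (mul_le_mul_of_nonneg_right (le_abs_self C) dist_nonneg).trans
        (mul_le_mul_of_nonneg_left (hσ i).le (abs_nonneg C))
    · simpa using hηε

end Filling

end MetricCurrent

theorem theorem1p1 {X : Type*} [MetricSpace X] [CompleteSpace X] [MeasurableSpace X]
    [BorelSpace X] (hX : MetricCurrent.IsQuasiconvex X)
    (T : MetricCurrent.Functional X 0) (hT : MetricCurrent.IsIntegral T)
    (Tm : ℕ → MetricCurrent.Functional X 0) (hTm : ∀ m, MetricCurrent.IsIntegral (Tm m))
    (hbdd : ∃ B : ℝ≥0, ∀ m, MetricCurrent.mass (Tm m) ≤ B) :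
    MetricCurrent.WeaklyConverges Tm T ↔
      Tendsto (fun m => MetricCurrent.fillvol (T - Tm m)) atTop (𝓝 0) :=
  ⟨MetricCurrent.tendsto_fillvol_of_weaklyConverges hX hT hTm hbdd,
    MetricCurrent.weaklyConverges_of_tendsto_fillvol⟩
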